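/- Let $k$ be a field. A \emph{weak Hopf algebra} over $k$ is a $k$-vector space $H$ which is an associative unital algebra and a coassociative counital coalgebra $(H,\Delta,\epsilon)$ (Sweedler notation $\Delta(h)=h_{(1)}\otimes h_{(2)}$) such that $\Delta(hg)=\Delta(h)\Delta(g)$, $(\Delta\otimes\mathrm{id})\Delta(1)=(\Delta(1)\otimes 1)(1\otimes\Delta(1))=(1\otimes\Delta(1))(\Delta(1)\otimes 1)$, $\epsilon(fgh)=\epsilon(fg_{(1)})\epsilon(g_{(2)}h)=\epsilon(fg_{(2)})\epsilon(g_{(1)}h)$, together with a linear map $S:H\to H$ (the antipode) such that $h_{(1)}S(h_{(2)})=\varepsilon_t(h)$, $S(h_{(1)})h_{(2)}=\varepsilon_s(h)$ and $S(h_{(1)})h_{(2)}S(h_{(3)})=S(h)$, where $\varepsilon_t(h)=\epsilon(1_{(1)}h)1_{(2)}$ and $\varepsilon_s(h)=1_{(1)}\epsilon(h1_{(2)})$. Put $H_t=\varepsilon_t(H)$, $H_s=\varepsilon_s(H)$, $H_{\min}=H_tH_s$. If $\dim_k H<\infty$, then $H^*=\mathrm{Hom}_k(H,k)$ is a weak Hopf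 algebra with the transposed operations: $(\phi\psi)(h)=\phi(h_{(1)})\psi(h_{(2)})$, $\langle\Delta(\phi),h\otimes g\rangle=\phi(hg)$, $S(\phi)=\phi\circ S$, unit $\epsilon$ and counit $\phi\mapsto\phi(1)$; and $H^{**}=H$. Write $\phi\rightharpoonup h=h_{(1)}\langle\phi,h_{(2)}\rangle$ and $h\leftharpoonup\phi=\langle\phi,h_{(1)}\rangle h_{(2)}$ for $\phi\in H^*$, $h\in H$, and similarly with $H$ and $H^*$ interchanged. A \emph{left integral} in $H$ is an element $\ell$ with $h\ell=\varepsilon_t(h)\ell$ for all $h\in H$; it is \emph{non-degenerate} if $(\phi,\psi)\mapsto\langle\phi\psi,\ell\rangle$ is a non-degenerate bilinear form on $H^*$. Left integrals $\ell\in H$ and $\lambda\in H^*$ are \emph{dual} to each other if $\lambda\rightharpoonup\ell=1$ (both are then non-degenerate). $G(H)$ denotes the group of \emph{group-like} elements of $H$: the invertible $g\in H$ with $\Delta(g)=(g\otimes g)\Delta(1)=\Delta(1)(g\otimes g)$; the \emph{trivial} ones are those of the form $S(y)y^{-1}$ with $y\in H_s$ invertible. An element $\alpha\in G(H^*)$ is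 \emph{distinguished} if $\alpha=\gamma_\ell\tau$, where $\tau\in H^*$ is a trivial group-like element and $\gamma_\ell\in H^*$ is the functional attached to a non-degenerate left integral $\ell$ of $H$ by $\gamma_\ell(h)=\epsilon(y)$, with $y\in H_s$ such that $\ell h=\ell y$. An element $a\in G(H)$ is \emph{distinguished} if it is so for $H^*$ in place of $H$, under $H=H^{**}$. \textbf{Theorem.} Let $H$ be a finite-dimensional weak Hopf algebra over a field $k$ which is a Frobenius algebra (it has a linear functional $f$ such that $(x,y)\mapsto f(xy)$ is non-degenerate), and suppose that $S^2=\mathrm{id}$ on $H_{\min}$. Let $\ell\in H$ and $\lambda\in H^*$ be a dual pair of left integrals, and put $$a=\ell\leftharpoonup\lambda\in H,\qquad \alpha=\lambda\leftharpoonup\ell\in H^*.$$ Then $a\in G(H)$ and $\alpha\in G(H^*)$ are distinguished group-like elements (in particular, invertible), and $$S^4(h)=a^{-1}\,(\alpha\rightharpoonup h\leftharpoonup\alpha^{-1})\,a\qquad\text{for all } h\in H.$$ -/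

import Mathlib

open scoped TensorProduct

section Counital

variable (k : Type*) {H : Type*} [Field k] [Ring H] [Algebra k H] [Coalgebra k H]

/-- The target counital map `ε_t(h) = ε(1₁ h) 1₂ = (ε ⊗ id)(Δ(1)(h ⊗ 1))`. -/
noncomputable def counitalTarget : H →ₗ[k] H :=
  (TensorProduct.lid k H).toLinearMap ∘ₗ
    (Coalgebra.counit (R := k) (A := H)).rTensor H ∘ₗ
      LinearMap.mulLeft k (Coalgebra.comul (R := k) (1 : H)) ∘ₗ
        (TensorProduct.mk k H H).flip 1

/-- The source counital map `ε_s(h) = 1₁ ε(h 1₂) = (id ⊗ ε)((1 ⊗ h)Δ(1))`. -/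
noncomputable def counitalSource : H →ₗ[k] H :=
  (TensorProduct.rid k H).toLinearMap ∘ₗ
    (Coalgebra.counit (R := k) (A := H)).lTensor H ∘ₗ
      LinearMap.mulRight k (Coalgebra.comul (R := k) (1 : H)) ∘ₗ
        TensorProduct.mk k H H 1

end Counital

/-- A weak Hopf algebra over a field `k`: an algebra and a coalgebra whose comultiplication is
multiplicative, with the weak unit and counit axioms, and with an antipode. -/
class WeakHopfAlgebra (k : Type*) (H : Type*) [Field k] [Ring H]
    extends Algebra k H, Coalgebra k H where
  /-- `Δ(hg) = Δ(h)Δ(g)` -/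
  comul_mul (h g : H) : comul (h * g) = comul h * comul g
  /-- `(Δ ⊗ id)Δ(1) = (Δ(1) ⊗ 1)(1 ⊗ Δ(1))` -/
  comul_comul_one (k) : comul.rTensor H (comul (1 : H)) =
    (comul (1 : H) ⊗ₜ[k] (1 : H)) * (TensorProduct.assoc k H H H).symm ((1 : H) ⊗ₜ[k] comul (1 : H))
  /-- `(Δ ⊗ id)Δ(1) = (1 ⊗ Δ(1))(Δ(1) ⊗ 1)` -/
  comul_comul_one' (k) : comul.rTensor H (comul (1 : H)) =
    (TensorProduct.assoc k H H H).symm ((1 : H) ⊗ₜ[k] comul (1 : H)) * (comul (1 : H) ⊗ₜ[k] (1 : H))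
  /-- `ε(fgh) = ε(f g₁) ε(g₂ h)` -/
  counit_mul_mul (f g h : H) : counit (f * g * h) =
    LinearMap.mul' k k (TensorProduct.map (counit ∘ₗ LinearMap.mulLeft k f)
      (counit ∘ₗ LinearMap.mulRight k h) (comul g))
  /-- `ε(fgh) = ε(f g₂) ε(g₁ h)` -/
  counit_mul_mul' (f g h : H) : counit (f * g * h) =
    LinearMap.mul' k k (TensorProduct.map (counit ∘ₗ LinearMap.mulRight k h)
      (counit ∘ₗ LinearMap.mulLeft k f) (comul g))
  /-- The antipode `S`. -/
  antipode (k) : H →ₗ[k] H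
  /-- `h₁ S(h₂) = ε_t(h)` -/
  mul_antipode (h : H) : LinearMap.mul' k H (antipode.lTensor H (comul h)) = counitalTarget k h
  /-- `S(h₁) h₂ = ε_s(h)` -/
  antipode_mul (h : H) : LinearMap.mul' k H (antipode.rTensor H (comul h)) = counitalSource k h
  /-- `S(h₁) h₂ S(h₃) = S(h)` -/
  antipode_mul_antipode (h : H) :
    LinearMap.mul' k H (TensorProduct.map antipode
      (LinearMap.mul' k H ∘ₗ antipode.lTensor H ∘ₗ comul) (comul h)) = antipode h

/-! ### The dual weak Hopf algebra -/

/-- The dual `H* = Hom_k(H, k)`, a copy of Mathlib's type `WithConv (H →ₗ[k] k)`, which carries the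
convolution product `(φψ)(h) = φ(h₁)ψ(h₂)`, with unit the counit of `H`. -/
def WDual (k H : Type*) [Field k] [Ring H] [WeakHopfAlgebra k H] : Type _ :=
  WithConv (H →ₗ[k] k)

namespace WDual

variable {k H : Type*} [Field k] [Ring H] [WeakHopfAlgebra k H]

noncomputable instance : Ring (WDual k H) :=
  inferInstanceAs (Ring (WithConv (H →ₗ[k] k)))

noncomputable instance : Algebra k (WDual k H) :=
  inferInstanceAs (Algebra k (WithConv (H →ₗ[k] k)))

/-- An element of `H*` is a linear functional on `H`, and conversely. -/
noncomputable def toDual : WDual k H ≃ₗ[k] Module.Dual k H where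
  toFun φ := φ.ofConv
  invFun f := WithConv.toConv f
  map_add' _ _ := rfl
  map_smul' _ _ := rfl
  left_inv _ := rfl
  right_inv _ := rfl

noncomputable instance : CoeFun (WDual k H) (fun _ => H → k) where
  coe φ := toDual φ

/-- Evaluation at `h` as a linear functional on `H*`. -/
noncomputable def evalAt (h : H) : Module.Dual k (WDual k H) :=
  LinearMap.applyₗ h ∘ₗ toDual.toLinearMap

theorem evalAt_apply (h : H) (φ : WDual k H) : evalAt h φ = φ h := rfl

@[ext] theorem ext {φ ψ : WDual k H} (hxy : ∀ h : H, φ h = ψ h) : φ = ψ :=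
  toDual.injective (LinearMap.ext hxy)

/-- Evaluation of an element of `H* ⊗ H*` at `h ⊗ g`. -/
noncomputable def ev₂ (h g : H) : WDual k H ⊗[k] WDual k H →ₗ[k] k :=
  LinearMap.mul' k k ∘ₗ TensorProduct.map (evalAt h) (evalAt g)

/-- Evaluation of an element of `H* ⊗ H* ⊗ H*` at `h ⊗ g ⊗ f`. -/
noncomputable def ev₃ (h g f : H) : (WDual k H ⊗[k] WDual k H) ⊗[k] WDual k H →ₗ[k] k :=
  LinearMap.mul' k k ∘ₗ TensorProduct.map (ev₂ h g) (evalAt f)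

theorem ev₂_tmul (h g : H) (φ ψ : WDual k H) : ev₂ h g (φ ⊗ₜ[k] ψ) = φ h * ψ g := rfl

theorem ev₃_tmul (h g f : H) (x : WDual k H ⊗[k] WDual k H) (ψ : WDual k H) :
    ev₃ h g f (x ⊗ₜ[k] ψ) = ev₂ h g x * ψ f := rfl

theorem mul_eval (φ ψ : WDual k H) (h : H) {ι : Type*} (r : Coalgebra.Repr k h ι) :
    (φ * ψ) h = ∑ i ∈ r.index, φ (r.left i) * ψ (r.right i) := r.convMul_apply φ ψ

theorem one_eval (h : H) : (1 : WDual k H) h = Coalgebra.counit (R := k) h := rfl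

theorem ev₂_mul (h g : H) (x y : WDual k H ⊗[k] WDual k H) {ι κ : Type*}
    (r : Coalgebra.Repr k h ι) (s : Coalgebra.Repr k g κ) :
    ev₂ h g (x * y) = ∑ i ∈ r.index, ∑ j ∈ s.index,
      ev₂ (r.left i) (s.left j) x * ev₂ (r.right i) (s.right j) y := by
  induction x with
  | zero => simp
  | add a b ha hb => simp [add_mul, ha, hb, Finset.sum_add_distrib]
  | tmul φ ψ =>
    induction y with
    | zero => simp
    | add a b ha hb => simp [mul_add, ha, hb, Finset.sum_add_distrib]
    | tmul φ' ψ' =>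
      rw [Algebra.TensorProduct.tmul_mul_tmul, ev₂_tmul, mul_eval _ _ _ r, mul_eval _ _ _ s,
        Finset.sum_mul_sum]
      simp only [ev₂_tmul]
      refine Finset.sum_congr rfl fun i _ => Finset.sum_congr rfl fun j _ => by ring

theorem ev₃_mul (h g f : H) (x y : (WDual k H ⊗[k] WDual k H) ⊗[k] WDual k H) {ι κ μ : Type*}
    (r : Coalgebra.Repr k h ι) (s : Coalgebra.Repr k g κ) (t : Coalgebra.Repr k f μ) :
    ev₃ h g f (x * y) = ∑ i ∈ r.index, ∑ j ∈ s.index, ∑ l ∈ t.index,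
      ev₃ (r.left i) (s.left j) (t.left l) x * ev₃ (r.right i) (s.right j) (t.right l) y := by
  induction x with
  | zero => simp
  | add a b ha hb => simp [add_mul, ha, hb, Finset.sum_add_distrib]
  | tmul φ ψ =>
    induction y with
    | zero => simp
    | add a b ha hb => simp [mul_add, ha, hb, Finset.sum_add_distrib]
    | tmul φ' ψ' =>
      rw [Algebra.TensorProduct.tmul_mul_tmul, ev₃_tmul, ev₂_mul h g φ φ' r s, mul_eval _ _ _ t]
      rw [Finset.sum_mul]
      refine Finset.sum_congr rfl fun i _ => ?_
      rw [Finset.sum_mul]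
      refine Finset.sum_congr rfl fun j _ => ?_
      rw [Finset.mul_sum]
      refine Finset.sum_congr rfl fun l _ => ?_
      rw [ev₃_tmul, ev₃_tmul]
      ring

theorem ev₃_assoc (φ : WDual k H) (x : WDual k H ⊗[k] WDual k H) (h g f : H) :
    ev₃ h g f ((TensorProduct.assoc k _ _ _).symm (φ ⊗ₜ[k] x)) = φ h * ev₂ g f x := by
  induction x with
  | zero => simp
  | add a b ha hb => simp [TensorProduct.tmul_add, mul_add, ha, hb]
  | tmul φ m => simp [ev₃_tmul, ev₂_tmul, mul_assoc]

/-- The antipode of `H*`, with `⟨S(φ), h⟩ = ⟨φ, S(h)⟩`. -/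
noncomputable def antipodeDual : WDual k H →ₗ[k] WDual k H :=
  (toDual (k := k) (H := H)).symm.toLinearMap ∘ₗ
    (WeakHopfAlgebra.antipode k (H := H)).dualMap ∘ₗ
      (toDual (k := k) (H := H)).toLinearMap

theorem antipodeDual_eval (φ : WDual k H) (h : H) :
    antipodeDual φ h = φ (WeakHopfAlgebra.antipode k h) := rfl

theorem sum_repr {M : Type*} [AddCommGroup M] [Module k M] (x : H) (f : H ⊗[k] H →ₗ[k] M)
    {ι : Type*} (r : Coalgebra.Repr k x ι) :
    f (Coalgebra.comul x) = ∑ i ∈ r.index, f (r.left i ⊗ₜ r.right i) := by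
  rw [← r.eq, map_sum]

theorem counit_sum_left (g : H →ₗ[k] k) (x : H) {ι : Type*} (r : Coalgebra.Repr k x ι) :
    ∑ i ∈ r.index, Coalgebra.counit (R := k) (r.left i) * g (r.right i) = g x := by
  have := congrArg (LinearMap.mul' k k ∘ₗ g.lTensor k) (Coalgebra.sum_counit_tmul_eq r)
  simpa only [map_sum, LinearMap.comp_apply, LinearMap.lTensor_tmul, LinearMap.mul'_apply,
    one_mul] using this

theorem counit_sum_right (g : H →ₗ[k] k) (x : H) {ι : Type*} (r : Coalgebra.Repr k x ι) :
    ∑ i ∈ r.index, g (r.left i) * Coalgebra.counit (R := k) (r.right i) = g x := by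
  have := congrArg (LinearMap.mul' k k ∘ₗ g.rTensor k) (Coalgebra.sum_tmul_counit_eq r)
  simpa only [map_sum, LinearMap.comp_apply, LinearMap.rTensor_tmul, LinearMap.mul'_apply,
    mul_one] using this

theorem counit_sum_left_mulLeft (x y : H) {ι : Type*} (r : Coalgebra.Repr k x ι) :
    Coalgebra.counit (R := k) (y * x) = ∑ i ∈ r.index,
      Coalgebra.counit (R := k) (r.left i) * Coalgebra.counit (R := k) (y * r.right i) :=
  (counit_sum_left (Coalgebra.counit ∘ₗ LinearMap.mulLeft k y) x r).symm

theorem counit_sum_left_mulRight (x y : H) {ι : Type*} (r : Coalgebra.Repr k x ι) :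
    Coalgebra.counit (R := k) (x * y) = ∑ i ∈ r.index,
      Coalgebra.counit (R := k) (r.left i) * Coalgebra.counit (R := k) (r.right i * y) :=
  (counit_sum_left (Coalgebra.counit ∘ₗ LinearMap.mulRight k y) x r).symm

theorem counit_sum_right_mulLeft (x y : H) {ι : Type*} (r : Coalgebra.Repr k x ι) :
    Coalgebra.counit (R := k) (y * x) = ∑ i ∈ r.index,
      Coalgebra.counit (R := k) (y * r.left i) * Coalgebra.counit (R := k) (r.right i) :=
  (counit_sum_right (Coalgebra.counit ∘ₗ LinearMap.mulLeft k y) x r).symm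

theorem counit_sum_right_mulRight (x y : H) {ι : Type*} (r : Coalgebra.Repr k x ι) :
    Coalgebra.counit (R := k) (x * y) = ∑ i ∈ r.index,
      Coalgebra.counit (R := k) (r.left i * y) * Coalgebra.counit (R := k) (r.right i) :=
  (counit_sum_right (Coalgebra.counit ∘ₗ LinearMap.mulRight k y) x r).symm

theorem mul'_eval (x : WDual k H ⊗[k] WDual k H) (h : H) {ι : Type*} (r : Coalgebra.Repr k h ι) :
    (LinearMap.mul' k (WDual k H) x) h = ∑ i ∈ r.index, ev₂ (r.left i) (r.right i) x := by
  induction x with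
  | zero => simp
  | add a b ha hb => simp [ha, hb, Finset.sum_add_distrib]
  | tmul φ ψ => rw [LinearMap.mul'_apply, mul_eval _ _ _ r]; rfl

theorem ev₂_map {A B : WDual k H →ₗ[k] WDual k H} {A' B' : H →ₗ[k] H}
    (hA : ∀ φ h, A φ h = φ (A' h)) (hB : ∀ φ h, B φ h = φ (B' h))
    (x : WDual k H ⊗[k] WDual k H) (h g : H) :
    ev₂ h g (TensorProduct.map A B x) = ev₂ (A' h) (B' g) x := by
  induction x with
  | zero => simp
  | add a b ha hb => simp [ha, hb]
  | tmul φ ψ => rw [TensorProduct.map_tmul, ev₂_tmul, ev₂_tmul, hA, hB]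

theorem triple_eval (φ ψ χ : WDual k H) (x : H) : (φ * ψ * χ) x =
    LinearMap.mul' k k (TensorProduct.map (LinearMap.mul' k k ∘ₗ
      TensorProduct.map (toDual φ) (toDual ψ)) (toDual χ)
      ((Coalgebra.comul (R := k) (A := H)).rTensor H (Coalgebra.comul x))) := by
  rw [mul_eval _ _ _ (Coalgebra.Repr.arbitrary k x), ← (Coalgebra.Repr.arbitrary k x).eq]
  simp only [map_sum, LinearMap.rTensor_tmul, TensorProduct.map_tmul, LinearMap.mul'_apply]
  rfl

variable [FiniteDimensional k H]

instance : FiniteDimensional k (WDual k H) :=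
  Module.Finite.equiv (toDual (k := k) (H := H)).symm

theorem tensor_ext {M : Type*} [AddCommGroup M] [Module k M] {x y : WDual k H ⊗[k] M}
    (hxy : ∀ h : H, TensorProduct.lid k M ((evalAt h).rTensor M x) =
      TensorProduct.lid k M ((evalAt h).rTensor M y)) : x = y := by
  let e : WDual k H ⊗[k] M ≃ₗ[k] (H →ₗ[k] M) :=
    (TensorProduct.congr (toDual (k := k) (H := H)) (LinearEquiv.refl k M)).trans
      (dualTensorHomEquiv k H M)
  have he : ∀ (z : WDual k H ⊗[k] M) (h : H),
      e z h = TensorProduct.lid k M ((evalAt h).rTensor M z) := by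
    intro z h
    induction z with
    | zero => simp
    | add a b ha hb => simp [ha, hb]
    | tmul φ m => simp [e, evalAt_apply]
  apply e.injective
  ext h
  rw [he, he, hxy]

theorem ext₂ {x y : WDual k H ⊗[k] WDual k H} (hxy : ∀ h g : H, ev₂ h g x = ev₂ h g y) :
    x = y := by
  have key : ∀ (h g : H) (z : WDual k H ⊗[k] WDual k H),
      ev₂ h g z = (TensorProduct.lid k _ ((evalAt h).rTensor _ z) : WDual k H) g := by
    intro h g z
    induction z with
    | zero => simp
    | add a b ha hb => simp [ha, hb]
    | tmul φ m => simp [ev₂_tmul, evalAt_apply]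
  refine tensor_ext fun h => ?_
  ext g
  rw [← key, ← key, hxy]

theorem ext₃ {x y : (WDual k H ⊗[k] WDual k H) ⊗[k] WDual k H}
    (hxy : ∀ h g f : H, ev₃ h g f x = ev₃ h g f y) : x = y := by
  have key : ∀ (h g f : H) (z : (WDual k H ⊗[k] WDual k H) ⊗[k] WDual k H),
      ev₃ h g f z = ev₂ h g (TensorProduct.lid k _
        ((evalAt f).rTensor _ (TensorProduct.comm k _ _ z))) := by
    intro h g f z
    induction z with
    | zero => simp
    | add a b ha hb => simp [ha, hb]
    | tmul φ m => simp [ev₃_tmul, evalAt_apply, mul_comm]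
  apply (TensorProduct.comm k _ _).injective
  refine tensor_ext fun f => ext₂ fun h g => ?_
  rw [← key, ← key, hxy]

/-- The comultiplication of `H*`, with `⟨Δ(φ), h ⊗ g⟩ = ⟨φ, hg⟩`. -/
noncomputable def comulDual : WDual k H →ₗ[k] WDual k H ⊗[k] WDual k H :=
  (TensorProduct.congr (toDual (k := k) (H := H)).symm
      (toDual (k := k) (H := H)).symm).toLinearMap ∘ₗ
    (TensorProduct.dualDistribEquiv k H H).symm.toLinearMap ∘ₗ
      (LinearMap.mul' k H).dualMap ∘ₗ (toDual (k := k) (H := H)).toLinearMap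

theorem ev₂_comulDual (φ : WDual k H) (h g : H) : ev₂ h g (comulDual φ) = φ (h * g) := by
  have key : ∀ z : Module.Dual k H ⊗[k] Module.Dual k H,
      ev₂ h g ((TensorProduct.congr (toDual (k := k) (H := H)).symm
        (toDual (k := k) (H := H)).symm) z) =
      TensorProduct.dualDistribEquiv k H H z (h ⊗ₜ g) := by
    intro z
    induction z with
    | zero => simp
    | add a b ha hb => simp [ha, hb]
    | tmul φ m => rfl
  rw [comulDual, LinearMap.comp_apply, LinearMap.comp_apply, LinearMap.comp_apply,
    LinearEquiv.coe_coe, LinearEquiv.coe_coe, LinearEquiv.coe_coe, key,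
    LinearEquiv.apply_symm_apply, LinearMap.dualMap_apply, LinearMap.mul'_apply]

/-- The counit of `H*`, `φ ↦ ⟨φ, 1⟩`. -/
noncomputable def counitDual : WDual k H →ₗ[k] k := evalAt 1

theorem ev₃_rTensor (x : WDual k H ⊗[k] WDual k H) (h g f : H) :
    ev₃ h g f (comulDual.rTensor _ x) = ev₂ (h * g) f x := by
  induction x with
  | zero => simp
  | add a b ha hb => simp [ha, hb]
  | tmul φ m => simp [ev₃_tmul, ev₂_tmul, ev₂_comulDual]

theorem ev₃_lTensor (x : WDual k H ⊗[k] WDual k H) (h g f : H) :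
    ev₃ h g f ((TensorProduct.assoc k _ _ _).symm (comulDual.lTensor _ x)) =
      ev₂ h (g * f) x := by
  induction x with
  | zero => simp
  | add a b ha hb => simp [ha, hb]
  | tmul φ m => rw [LinearMap.lTensor_tmul, ev₃_assoc, ev₂_tmul, ev₂_comulDual]

noncomputable instance : Coalgebra k (WDual k H) where
  comul := comulDual
  counit := counitDual
  coassoc := by
    ext1 φ
    apply (TensorProduct.assoc k _ _ _).symm.injective
    refine ext₃ fun h g f => ?_
    simp only [LinearMap.comp_apply, LinearEquiv.coe_coe, LinearEquiv.symm_apply_apply]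
    rw [ev₃_rTensor, ev₃_lTensor, ev₂_comulDual, ev₂_comulDual, mul_assoc]
  rTensor_counit_comp_comul := by
    ext1 φ
    apply (TensorProduct.lid k _).injective
    ext g
    have key : ∀ x : WDual k H ⊗[k] WDual k H,
        (TensorProduct.lid k _ (counitDual.rTensor _ x) : WDual k H) g = ev₂ 1 g x := by
      intro x
      induction x with
      | zero => simp
      | add a b ha hb => simp [ha, hb]
      | tmul φ m => simp [ev₂_tmul, counitDual, evalAt_apply]
    simp [key, ev₂_comulDual]
  lTensor_counit_comp_comul := by
    ext1 φ
    apply (TensorProduct.rid k _).injective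
    ext g
    have key : ∀ x : WDual k H ⊗[k] WDual k H,
        (TensorProduct.rid k _ (counitDual.lTensor _ x) : WDual k H) g = ev₂ g 1 x := by
      intro x
      induction x with
      | zero => simp
      | add a b ha hb => simp [ha, hb]
      | tmul φ m => simp [ev₂_tmul, counitDual, evalAt_apply, mul_comm]
    simp [key, ev₂_comulDual]

theorem ev₂_comul (φ : WDual k H) (h g : H) :
    ev₂ h g (Coalgebra.comul (R := k) φ) = φ (h * g) := ev₂_comulDual φ h g

theorem counit_eval (φ : WDual k H) : Coalgebra.counit (R := k) φ = φ 1 := rfl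

theorem counitalTarget_eval (φ : WDual k H) (h : H) :
    counitalTarget k φ h = φ (counitalTarget k h) := by
  have key : ∀ x : WDual k H ⊗[k] WDual k H,
      (TensorProduct.lid k (WDual k H)
        ((Coalgebra.counit (R := k) (A := WDual k H)).rTensor _ x)) h = ev₂ 1 h x := by
    intro x
    induction x with
    | zero => simp
    | add a b ha hb => simp [ha, hb]
    | tmul φ m => simp [ev₂_tmul, counit_eval]
  let r := Coalgebra.Repr.arbitrary k (1 : H)
  let s := Coalgebra.Repr.arbitrary k h
  trans ∑ i ∈ r.index, Coalgebra.counit (R := k) (r.left i * h) * φ (r.right i)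
  · trans ev₂ 1 h (Coalgebra.comul (R := k) (1 : WDual k H) * (φ ⊗ₜ[k] 1))
    · exact key _
    · rw [ev₂_mul 1 h _ _ r s]
      refine Finset.sum_congr rfl fun i _ => ?_
      rw [counit_sum_right_mulLeft h (r.left i) s, Finset.sum_mul]
      refine Finset.sum_congr rfl fun j _ => ?_
      rw [ev₂_comul, ev₂_tmul, one_eval, one_eval]
      ring
  · simp only [counitalTarget, LinearMap.comp_apply, LinearMap.mulLeft_apply,
      LinearMap.flip_apply, TensorProduct.mk_apply, ← r.eq, Finset.sum_mul, map_sum,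
      Algebra.TensorProduct.tmul_mul_tmul, mul_one, LinearMap.rTensor_tmul, LinearEquiv.coe_coe,
      TensorProduct.lid_tmul, map_smul, smul_eq_mul]

theorem counitalSource_eval (φ : WDual k H) (h : H) :
    counitalSource k φ h = φ (counitalSource k h) := by
  have key : ∀ x : WDual k H ⊗[k] WDual k H,
      (TensorProduct.rid k (WDual k H)
        ((Coalgebra.counit (R := k) (A := WDual k H)).lTensor _ x)) h = ev₂ h 1 x := by
    intro x
    induction x with
    | zero => simp
    | add a b ha hb => simp [ha, hb]
    | tmul φ m => simp [ev₂_tmul, counit_eval, mul_comm]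
  let r := Coalgebra.Repr.arbitrary k (1 : H)
  let s := Coalgebra.Repr.arbitrary k h
  trans ∑ i ∈ r.index, Coalgebra.counit (R := k) (h * r.right i) * φ (r.left i)
  · trans ev₂ h 1 (((1 : WDual k H) ⊗ₜ[k] φ) * Coalgebra.comul (R := k) (1 : WDual k H))
    · exact key _
    · rw [ev₂_mul h 1 _ _ s r, Finset.sum_comm]
      refine Finset.sum_congr rfl fun i _ => ?_
      rw [counit_sum_left_mulRight h (r.right i) s, Finset.sum_mul]
      refine Finset.sum_congr rfl fun j _ => ?_
      rw [ev₂_comul, ev₂_tmul, one_eval, one_eval]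
      ring
  · simp only [counitalSource, LinearMap.comp_apply, LinearMap.mulRight_apply,
      TensorProduct.mk_apply, ← r.eq, Finset.mul_sum, map_sum,
      Algebra.TensorProduct.tmul_mul_tmul, one_mul, LinearMap.lTensor_tmul, LinearEquiv.coe_coe,
      TensorProduct.rid_tmul, map_smul, smul_eq_mul]

theorem mul_antipodeDual (φ : WDual k H) :
    LinearMap.mul' k (WDual k H) (antipodeDual.lTensor _ (Coalgebra.comul φ)) =
      counitalTarget k φ := by
  ext h
  let r := Coalgebra.Repr.arbitrary k h
  rw [counitalTarget_eval, ← WeakHopfAlgebra.mul_antipode, ← r.eq, mul'_eval _ _ r]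
  simp only [map_sum, LinearMap.lTensor_tmul, LinearMap.mul'_apply]
  refine Finset.sum_congr rfl fun i _ => ?_
  rw [LinearMap.lTensor, ev₂_map (A' := LinearMap.id) (fun _ _ => rfl) antipodeDual_eval,
    ev₂_comul, LinearMap.id_apply]

theorem antipodeDual_mul (φ : WDual k H) :
    LinearMap.mul' k (WDual k H) (antipodeDual.rTensor _ (Coalgebra.comul φ)) =
      counitalSource k φ := by
  ext h
  let r := Coalgebra.Repr.arbitrary k h
  rw [counitalSource_eval, ← WeakHopfAlgebra.antipode_mul, ← r.eq, mul'_eval _ _ r]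
  simp only [map_sum, LinearMap.rTensor_tmul, LinearMap.mul'_apply]
  refine Finset.sum_congr rfl fun i _ => ?_
  rw [LinearMap.rTensor, ev₂_map (B' := LinearMap.id) antipodeDual_eval (fun _ _ => rfl),
    ev₂_comul, LinearMap.id_apply]

theorem comulDual_mul (φ ψ : WDual k H) : Coalgebra.comul (R := k) (φ * ψ) =
    Coalgebra.comul (R := k) φ * Coalgebra.comul (R := k) ψ := by
  refine ext₂ fun h g => ?_
  let r := Coalgebra.Repr.arbitrary k h
  let s := Coalgebra.Repr.arbitrary k g
  rw [ev₂_comul, ev₂_mul h g _ _ r s]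
  change LinearMap.mul' k k (TensorProduct.map (toDual φ) (toDual ψ)
    (Coalgebra.comul (R := k) (h * g))) = _
  rw [WeakHopfAlgebra.comul_mul, ← r.eq, ← s.eq, Finset.sum_mul_sum]
  simp only [map_sum, Algebra.TensorProduct.tmul_mul_tmul, TensorProduct.map_tmul,
    LinearMap.mul'_apply, ev₂_comul]

theorem comul_comulDual_one : (Coalgebra.comul (R := k) (A := WDual k H)).rTensor (WDual k H)
      (Coalgebra.comul (1 : WDual k H)) =
    (Coalgebra.comul (1 : WDual k H) ⊗ₜ[k] (1 : WDual k H)) *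
      (TensorProduct.assoc k _ _ _).symm ((1 : WDual k H) ⊗ₜ[k] Coalgebra.comul (1 : WDual k H)) := by
  refine ext₃ fun h g f => ?_
  let r := Coalgebra.Repr.arbitrary k h
  let s := Coalgebra.Repr.arbitrary k g
  let t := Coalgebra.Repr.arbitrary k f
  have h1 := ev₃_rTensor (Coalgebra.comul (1 : WDual k H)) h g f
  rw [ev₂_comul] at h1
  refine h1.trans ?_
  rw [ev₃_mul h g f _ _ r s t, one_eval, WeakHopfAlgebra.counit_mul_mul, ← s.eq]
  simp only [map_sum, ev₃_tmul, ev₃_assoc, ev₂_comul, one_eval, TensorProduct.map_tmul,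
    LinearMap.mul'_apply, LinearMap.comp_apply, LinearMap.mulLeft_apply, LinearMap.mulRight_apply]
  rw [Finset.sum_comm (s := r.index)]
  refine Finset.sum_congr rfl fun j _ => ?_
  rw [counit_sum_right_mulRight h (s.left j) r, counit_sum_left_mulLeft f (s.right j) t,
    Finset.sum_mul_sum]
  refine Finset.sum_congr rfl fun i _ => Finset.sum_congr rfl fun l _ => ?_
  ring

theorem comul_comulDual_one' : (Coalgebra.comul (R := k) (A := WDual k H)).rTensor (WDual k H)
      (Coalgebra.comul (1 : WDual k H)) =
    (TensorProduct.assoc k _ _ _).symm ((1 : WDual k H) ⊗ₜ[k] Coalgebra.comul (1 : WDual k H)) *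
      (Coalgebra.comul (1 : WDual k H) ⊗ₜ[k] (1 : WDual k H)) := by
  refine ext₃ fun h g f => ?_
  let r := Coalgebra.Repr.arbitrary k h
  let s := Coalgebra.Repr.arbitrary k g
  let t := Coalgebra.Repr.arbitrary k f
  have h1 := ev₃_rTensor (Coalgebra.comul (1 : WDual k H)) h g f
  rw [ev₂_comul] at h1
  refine h1.trans ?_
  rw [ev₃_mul h g f _ _ r s t, one_eval, WeakHopfAlgebra.counit_mul_mul', ← s.eq]
  simp only [map_sum, ev₃_tmul, ev₃_assoc, ev₂_comul, one_eval, TensorProduct.map_tmul,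
    LinearMap.mul'_apply, LinearMap.comp_apply, LinearMap.mulLeft_apply, LinearMap.mulRight_apply]
  rw [Finset.sum_comm (s := r.index)]
  refine Finset.sum_congr rfl fun j _ => ?_
  rw [mul_comm, counit_sum_left_mulRight h (s.right j) r, counit_sum_right_mulLeft f (s.left j) t,
    Finset.sum_mul_sum]
  refine Finset.sum_congr rfl fun i _ => Finset.sum_congr rfl fun l _ => ?_
  ring

theorem counitDual_mul_mul (φ ψ χ : WDual k H) : Coalgebra.counit (R := k) (φ * ψ * χ) =
    LinearMap.mul' k k (TensorProduct.map (Coalgebra.counit ∘ₗ LinearMap.mulLeft k φ)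
      (Coalgebra.counit ∘ₗ LinearMap.mulRight k χ) (Coalgebra.comul ψ)) := by
  let r := Coalgebra.Repr.arbitrary k (1 : H)
  have key : ∀ x : WDual k H ⊗[k] WDual k H,
      LinearMap.mul' k k (TensorProduct.map (Coalgebra.counit ∘ₗ LinearMap.mulLeft k φ)
      (Coalgebra.counit ∘ₗ LinearMap.mulRight k χ) x) =
      ∑ i ∈ r.index, ∑ j ∈ r.index, φ (r.left i) * χ (r.right j) * ev₂ (r.right i) (r.left j) x := by
    intro x
    induction x with
    | zero => simp
    | add a b ha hb => simp only [map_add, ha, hb, mul_add, Finset.sum_add_distrib]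
    | tmul a b =>
      rw [TensorProduct.map_tmul, LinearMap.mul'_apply]
      simp only [LinearMap.comp_apply, LinearMap.mulLeft_apply, LinearMap.mulRight_apply,
        counit_eval]
      rw [mul_eval _ _ 1 r, mul_eval _ _ 1 r, Finset.sum_mul_sum]
      refine Finset.sum_congr rfl fun i _ => Finset.sum_congr rfl fun j _ => ?_
      rw [ev₂_tmul]
      ring
  rw [key, counit_eval, triple_eval, WeakHopfAlgebra.comul_comul_one k, ← r.eq,
    TensorProduct.sum_tmul, TensorProduct.tmul_sum, map_sum, Finset.sum_mul_sum]
  simp only [map_sum, TensorProduct.assoc_symm_tmul, Algebra.TensorProduct.tmul_mul_tmul,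
    TensorProduct.map_tmul, LinearMap.mul'_apply, LinearMap.comp_apply, one_mul, mul_one,
    ev₂_comul]
  refine Finset.sum_congr rfl fun i _ => Finset.sum_congr rfl fun j _ => ?_
  ring

theorem counitDual_mul_mul' (φ ψ χ : WDual k H) : Coalgebra.counit (R := k) (φ * ψ * χ) =
    LinearMap.mul' k k (TensorProduct.map (Coalgebra.counit ∘ₗ LinearMap.mulRight k χ)
      (Coalgebra.counit ∘ₗ LinearMap.mulLeft k φ) (Coalgebra.comul ψ)) := by
  let r := Coalgebra.Repr.arbitrary k (1 : H)
  have key : ∀ x : WDual k H ⊗[k] WDual k H,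
      LinearMap.mul' k k (TensorProduct.map (Coalgebra.counit ∘ₗ LinearMap.mulRight k χ)
      (Coalgebra.counit ∘ₗ LinearMap.mulLeft k φ) x) =
      ∑ i ∈ r.index, ∑ j ∈ r.index, φ (r.left i) * χ (r.right j) * ev₂ (r.left j) (r.right i) x := by
    intro x
    induction x with
    | zero => simp
    | add a b ha hb => simp only [map_add, ha, hb, mul_add, Finset.sum_add_distrib]
    | tmul a b =>
      rw [TensorProduct.map_tmul, LinearMap.mul'_apply]
      simp only [LinearMap.comp_apply, LinearMap.mulLeft_apply, LinearMap.mulRight_apply,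
        counit_eval]
      rw [mul_eval _ _ 1 r, mul_eval _ _ 1 r, Finset.sum_mul_sum, Finset.sum_comm]
      refine Finset.sum_congr rfl fun i _ => Finset.sum_congr rfl fun j _ => ?_
      rw [ev₂_tmul]
      ring
  rw [key, counit_eval, triple_eval, WeakHopfAlgebra.comul_comul_one' k, ← r.eq,
    TensorProduct.sum_tmul, TensorProduct.tmul_sum, map_sum, Finset.sum_mul_sum, Finset.sum_comm]
  simp only [map_sum, TensorProduct.assoc_symm_tmul, Algebra.TensorProduct.tmul_mul_tmul,
    TensorProduct.map_tmul, LinearMap.mul'_apply, LinearMap.comp_apply, one_mul, mul_one,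
    ev₂_comul]
  refine Finset.sum_congr rfl fun i _ => Finset.sum_congr rfl fun j _ => ?_
  ring

noncomputable instance : WeakHopfAlgebra k (WDual k H) where
  comul_mul := comulDual_mul
  comul_comul_one := comul_comulDual_one
  comul_comul_one' := comul_comulDual_one'
  counit_mul_mul := counitDual_mul_mul
  counit_mul_mul' := counitDual_mul_mul'
  antipode := antipodeDual
  mul_antipode := mul_antipodeDual
  antipode_mul := antipodeDual_mul
  antipode_mul_antipode φ := by
    ext h
    let r := Coalgebra.Repr.arbitrary k h
    have e1 : LinearMap.mul' k (WDual k H) ∘ₗ antipodeDual.lTensor _ ∘ₗ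
        Coalgebra.comul (R := k) (A := WDual k H) = counitalTarget k :=
      LinearMap.ext mul_antipodeDual
    have e2 : LinearMap.mul' k H ∘ₗ (WeakHopfAlgebra.antipode k (H := H)).lTensor _ ∘ₗ
        Coalgebra.comul (R := k) (A := H) = counitalTarget k :=
      LinearMap.ext WeakHopfAlgebra.mul_antipode
    rw [antipodeDual_eval, ← WeakHopfAlgebra.antipode_mul_antipode h, e1, e2, ← r.eq,
      mul'_eval _ _ r]
    simp only [map_sum, TensorProduct.map_tmul, LinearMap.mul'_apply]
    refine Finset.sum_congr rfl fun i _ => ?_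
    rw [ev₂_map antipodeDual_eval counitalTarget_eval, ev₂_comul]

end WDual

/-! ### Group-like elements and integrals -/

/-- A linear functional `f` on an algebra is non-degenerate if the bilinear form
`(x, y) ↦ f (x * y)` is non-degenerate. -/
def IsNondegenerateFunctional {k A : Type*} [Field k] [Ring A] [Algebra k A]
    (f : Module.Dual k A) : Prop :=
  (∀ x : A, (∀ y : A, f (x * y) = 0) → x = 0) ∧ (∀ y : A, (∀ x : A, f (x * y) = 0) → y = 0)

/-- A Frobenius algebra: a finite-dimensional algebra with a non-degenerate linear functional. -/
def IsFrobeniusAlgebra (k A : Type*) [Field k] [Ring A] [Algebra k A] : Prop :=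
  FiniteDimensional k A ∧ ∃ f : Module.Dual k A, IsNondegenerateFunctional f

namespace WeakHopfAlgebra

section Arrows

variable {k C : Type*} [Field k] [AddCommGroup C] [Module k C] [Coalgebra k C]

/-- The Sweedler arrow `f ⇀ c = c₁ ⟨f, c₂⟩` of a functional `f` on a coalgebra. -/
noncomputable def leftArrow (f : Module.Dual k C) (c : C) : C :=
  TensorProduct.rid k C (f.lTensor C (Coalgebra.comul c))

/-- The Sweedler arrow `c ↼ f = ⟨f, c₁⟩ c₂` of a functional `f` on a coalgebra. -/
noncomputable def rightArrow (c : C) (f : Module.Dual k C) : C :=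
  TensorProduct.lid k C (f.rTensor C (Coalgebra.comul c))

end Arrows

section Defs

variable (k : Type*) {H : Type*} [Field k] [Ring H] [WeakHopfAlgebra k H]

/-- The target base `H_t = ε_t(H)`. -/
noncomputable def targetBase (H : Type*) [Ring H] [WeakHopfAlgebra k H] : Submodule k H :=
  LinearMap.range (counitalTarget k (H := H))

/-- The source base `H_s = ε_s(H)`. -/
noncomputable def sourceBase (H : Type*) [Ring H] [WeakHopfAlgebra k H] : Submodule k H :=
  LinearMap.range (counitalSource k (H := H))

/-- The minimal weak Hopf subalgebra `H_min = H_t H_s`. -/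
noncomputable def minimalSubalgebra (H : Type*) [Ring H] [WeakHopfAlgebra k H] : Submodule k H :=
  targetBase k H * sourceBase k H

/-- `g` is group-like: invertible, with `Δ(g) = (g ⊗ g)Δ(1)` and `Δ(g) = Δ(1)(g ⊗ g)`. -/
def IsGroupLike (g : H) : Prop :=
  IsUnit g ∧
    Coalgebra.comul (R := k) g = (g ⊗ₜ[k] g) * Coalgebra.comul (1 : H) ∧
    Coalgebra.comul (R := k) g = Coalgebra.comul (1 : H) * (g ⊗ₜ[k] g)

/-- A trivial group-like element: one of the form `S(y)y⁻¹` with `y ∈ H_s` invertible. -/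
def IsTrivialGroupLike (g : H) : Prop :=
  ∃ y : Hˣ, (y : H) ∈ sourceBase k H ∧ g = antipode k (y : H) * (↑y⁻¹ : H)

/-- `ℓ` is a left integral: `hℓ = ε_t(h)ℓ` for all `h`. -/
def IsLeftIntegral (ℓ : H) : Prop :=
  ∀ h : H, h * ℓ = counitalTarget k h * ℓ

variable {k}

/-- A non-degenerate left integral: a left integral of `H` that is non-degenerate as a functional
on the algebra `H*`. -/
def IsNondegenerateLeftIntegral (k : Type*) {H : Type*} [Field k] [Ring H] [WeakHopfAlgebra k H]
    (ℓ : H) : Prop :=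
  IsLeftIntegral k ℓ ∧ IsNondegenerateFunctional (WDual.evalAt (k := k) ℓ)

/-- `γ` is the functional `h ↦ ε(1 · h)`, where `y = 1 · h` is the element of `H_s` with
`ℓh = ℓy`, i.e. `·` is the right action of `H` on `H_s` given by `ℓyh = ℓ(y · h)`. -/
def IsModularFunctional (ℓ : H) (γ : WDual k H) : Prop :=
  ∀ h : H, ∃ y ∈ sourceBase k H, ℓ * h = ℓ * y ∧ γ h = Coalgebra.counit (R := k) y

variable [FiniteDimensional k H]

/-- Left integrals `ℓ` of `H` and `lam` of `H*` are dual to each other if `lam ⇀ ℓ = 1`. -/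
def IsDualPair (ℓ : H) (lam : WDual k H) : Prop :=
  IsLeftIntegral k ℓ ∧ IsLeftIntegral k lam ∧ leftArrow (WDual.toDual lam) ℓ = 1

/-- `α ∈ G(H*)` is distinguished: it represents, modulo trivial group-like elements of `H*`, the
coset of the functional `γ` attached to a non-degenerate left integral of `H`. -/
def IsDistinguished (α : WDual k H) : Prop :=
  IsGroupLike k α ∧ ∃ (ℓ : H) (γ τ : WDual k H), IsNondegenerateLeftIntegral k ℓ ∧
    IsModularFunctional ℓ γ ∧ IsTrivialGroupLike k τ ∧ α = γ * τ

/-- `a ∈ G(H)` is distinguished: as an element of `H** = H`, it is distinguished for `H*`. -/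
def IsDistinguishedElement (k : Type*) {H : Type*} [Field k] [Ring H] [WeakHopfAlgebra k H]
    [FiniteDimensional k H] (a : H) : Prop :=
  IsGroupLike k a ∧ IsDistinguished (WDual.toDual.symm (WDual.evalAt (k := k) a))

end Defs

end WeakHopfAlgebra

/-!
Radford's formula for the fourth power of the antipode of a finite-dimensional weak Hopf algebra
`H`, for a dual pair `ℓ ∈ H`, `λ ∈ H*` of left integrals. The functional `λ` is a Frobenius
functional, and the formula comes from computing its Nakayama automorphism `N`, characterized by
`λ(nu) = λ(u N(n))`, in two ways: once with `α = λ ↼ ℓ`, once with `a = ℓ ↼ λ`.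

*Non-degeneracy.* Left integrals satisfy `ℓ₁ ⊗ hℓ₂ = S(h)ℓ₁ ⊗ ℓ₂`, whence `S(h) = ℓ₁ λ(hℓ₂)` for a
dual pair (`IsDualPair.leftArrow_mulLeft`). So `λ` and `ℓ` are non-degenerate as soon as `S` is
injective, and this holds in finite dimension: `S` is an epimorphism, in that algebra homomorphisms
`θ`, `ρ` that agree on its range are equal, by `θ(h) = θ(h₁) ρ(S(h₂)h₃) = θ(h₁S(h₂)) ρ(h₃) = ρ(h)`.
By Fitting's lemma, the projection to the range of a high power of `S²` is an algebra homomorphism;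
it agrees with the identity on that range, hence is the identity (`antipode_injective`).

*The group-like elements.* Non-degeneracy gives an anti-isomorphism `κ : H_s → H_t` with
`ℓy = ℓκ(y)`. When `S²` is the identity on `H_t` and `H_s`, the tensors `1₁ ⊗ S(1₂)` and
`S(1₁) ⊗ 1₂` are Casimir elements of `H_s` and `H_t`, with the counit as trace, and `κ` carries the
one to the other (`IsDualPair.sum_modularMap_base`). From this `Δ(α) = (α ⊗ α)Δ(1)`, `S(α) = α⁻¹`,
and `ε(κ(y)) = ε(y)`; the last equality says that `α` is the functional `γ_ℓ` attached to `ℓ`, so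
that `α` is distinguished, with trivial factor `1` (`IsDualPair.isDistinguished_rightArrow`). Since
`λ` and `ℓ`, viewed in `H**`, are a dual pair for `H*` (`IsDualPair.dual`), the same holds for `a`.

*The Nakayama automorphism.* The identity `ℓ₁x ⊗ ℓ₂ = ℓ₁ ⊗ ℓ₂ S(x ↼ α)`
(`IsDualPair.comul_mul_tmul_one`) yields `N(h) = S²(α⁻¹ ⇀ h)` (`IsDualPair.apply_mul_comm`). The
same identity in `H*` reads `λ(h₁g)h₂ = λ(hg₁) a S(g₂)` (`IsDualPair.sum_apply_mul_smul`); used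
twice, with `g` chosen such that `ε = λ(g ·)`, it yields `h ↼ α⁻¹ = a S²(N(h)) a⁻¹`
(`IsDualPair.rightArrow_antipode_eq`). Replacing `h` by `α ⇀ h` gives the formula.
-/

namespace WeakHopfAlgebra

open Coalgebra TensorProduct

/-! ### The counital maps and the comultiplication -/

section Counital

variable {k H : Type*} [Field k] [Ring H] [WeakHopfAlgebra k H]

theorem counitalTarget_apply (h : H) {ι : Type*} (r : Repr k (1 : H) ι) :
    counitalTarget k h = ∑ i ∈ r.index, counit (R := k) (r.left i * h) • r.right i := by
  simp [counitalTarget, ← r.eq, Finset.sum_mul]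

theorem counitalSource_apply (h : H) {ι : Type*} (r : Repr k (1 : H) ι) :
    counitalSource k h = ∑ i ∈ r.index, counit (R := k) (h * r.right i) • r.left i := by
  simp [counitalSource, ← r.eq, Finset.mul_sum]

variable (k) in
/-- The opposite target counital map `ε̃_t(h) = ε(h 1₁) 1₂`. -/
noncomputable def counitalTargetOp : H →ₗ[k] H :=
  (TensorProduct.lid k H).toLinearMap ∘ₗ (counit (R := k) (A := H)).rTensor H ∘ₗ
    LinearMap.mulRight k (comul (R := k) (1 : H)) ∘ₗ (TensorProduct.mk k H H).flip 1

variable (k) in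
/-- The opposite source counital map `ε̃_s(h) = 1₁ ε(1₂ h)`. -/
noncomputable def counitalSourceOp : H →ₗ[k] H :=
  (TensorProduct.rid k H).toLinearMap ∘ₗ (counit (R := k) (A := H)).lTensor H ∘ₗ
    LinearMap.mulLeft k (comul (R := k) (1 : H)) ∘ₗ TensorProduct.mk k H H 1

theorem counitalTargetOp_apply (h : H) {ι : Type*} (r : Repr k (1 : H) ι) :
    counitalTargetOp k h = ∑ i ∈ r.index, counit (R := k) (h * r.left i) • r.right i := by
  simp [counitalTargetOp, ← r.eq, Finset.mul_sum]

theorem counitalSourceOp_apply (h : H) {ι : Type*} (r : Repr k (1 : H) ι) :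
    counitalSourceOp k h = ∑ i ∈ r.index, counit (R := k) (r.right i * h) • r.left i := by
  simp [counitalSourceOp, ← r.eq, Finset.sum_mul]

theorem sum_counit_smul_right (h : H) {ι : Type*} (r : Repr k h ι) :
    ∑ i ∈ r.index, counit (R := k) (r.right i) • r.left i = h := by
  have := congrArg (TensorProduct.rid k H) (sum_tmul_counit_eq (R := k) r)
  simpa only [map_sum, TensorProduct.rid_tmul, one_smul] using this

theorem rTensor_comul_mul (x y : H ⊗[k] H) :
    (comul (R := k) (A := H)).rTensor H (x * y) = comul.rTensor H x * comul.rTensor H y := by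
  induction x with
  | zero => simp
  | add a b ha hb => simp only [add_mul, map_add, ha, hb]
  | tmul a b =>
    induction y with
    | zero => simp
    | add a b ha hb => simp only [mul_add, map_add, ha, hb]
    | tmul c d => simp [comul_mul]

/-- The map `a ⊗ b ⊗ c ↦ ε(b) a ⊗ c`, which splits `Δ ⊗ id`. -/
theorem contract_rTensor_comul (x : H ⊗[k] H) :
    ((TensorProduct.rid k H).toLinearMap ∘ₗ counit.lTensor H).rTensor H
      ((comul (R := k) (A := H)).rTensor H x) = x := by
  induction x with
  | zero => simp
  | add a b ha hb => simp only [map_add, ha, hb]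
  | tmul a b => simp

theorem one_mul_comul (h : H) : comul (R := k) (1 : H) * comul h = comul h := by
  rw [← comul_mul, one_mul]

theorem comul_mul_one (h : H) : comul (R := k) h * comul (1 : H) = comul h := by
  rw [← comul_mul, mul_one]

/-- `h₁ ⊗ ε_t(h₂) = 1₁ h ⊗ 1₂`. -/
theorem lTensor_counitalTarget_comul (h : H) :
    (counitalTarget k).lTensor H (comul (R := k) h) = comul (1 : H) * (h ⊗ₜ[k] (1 : H)) := by
  have key (E X : H ⊗[k] H) :
      ((TensorProduct.rid k H).toLinearMap ∘ₗ counit.lTensor H).rTensor H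
        ((TensorProduct.assoc k H H H).symm ((1 : H) ⊗ₜ[k] E) * (X ⊗ₜ[k] (1 : H))) =
      ((TensorProduct.lid k H).toLinearMap ∘ₗ (counit (R := k) (A := H)).rTensor H ∘ₗ
        LinearMap.mulLeft k E ∘ₗ (TensorProduct.mk k H H).flip 1).lTensor H X := by
    induction X with
    | zero => simp
    | add a b ha hb => simp only [map_add, ha, hb, add_tmul, mul_add]
    | tmul a b =>
      induction E with
      | zero => simp
      | add c d hc hd =>
        simp only [tmul_add, map_add, hc, hd, add_mul, LinearMap.lTensor_tmul,
          LinearMap.comp_apply, LinearMap.mulLeft_apply]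
      | tmul c d => simp [smul_tmul]
  rw [← contract_rTensor_comul (comul (1 : H) * (h ⊗ₜ[k] (1 : H))), rTensor_comul_mul,
    comul_comul_one', mul_assoc, LinearMap.rTensor_tmul, Algebra.TensorProduct.tmul_mul_tmul,
    one_mul_comul, mul_one, key]
  rfl

/-- `h₁ ⊗ ε̃_t(h₂) = h 1₁ ⊗ 1₂`. -/
theorem lTensor_counitalTargetOp_comul (h : H) :
    (counitalTargetOp k).lTensor H (comul (R := k) h) = (h ⊗ₜ[k] (1 : H)) * comul (1 : H) := by
  have key (E X : H ⊗[k] H) :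
      ((TensorProduct.rid k H).toLinearMap ∘ₗ counit.lTensor H).rTensor H
        ((X ⊗ₜ[k] (1 : H)) * (TensorProduct.assoc k H H H).symm ((1 : H) ⊗ₜ[k] E)) =
      ((TensorProduct.lid k H).toLinearMap ∘ₗ (counit (R := k) (A := H)).rTensor H ∘ₗ
        LinearMap.mulRight k E ∘ₗ (TensorProduct.mk k H H).flip 1).lTensor H X := by
    induction X with
    | zero => simp
    | add a b ha hb => simp only [map_add, ha, hb, add_tmul, add_mul]
    | tmul a b =>
      induction E with
      | zero => simp
      | add c d hc hd =>
        simp only [tmul_add, map_add, hc, hd, mul_add, LinearMap.lTensor_tmul,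
          LinearMap.comp_apply, LinearMap.mulRight_apply]
      | tmul c d => simp [smul_tmul]
  rw [← contract_rTensor_comul ((h ⊗ₜ[k] (1 : H)) * comul (1 : H)), rTensor_comul_mul,
    comul_comul_one, ← mul_assoc, LinearMap.rTensor_tmul, Algebra.TensorProduct.tmul_mul_tmul,
    comul_mul_one, mul_one, key]
  rfl

/-- `ε_s(h₁) ⊗ h₂ = 1₁ ⊗ h 1₂`. -/
theorem rTensor_counitalSource_comul (h : H) :
    (counitalSource k).rTensor H (comul (R := k) h) = ((1 : H) ⊗ₜ[k] h) * comul (1 : H) := by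
  have key (E X : H ⊗[k] H) :
      ((TensorProduct.rid k H).toLinearMap ∘ₗ counit.lTensor H).rTensor H
        ((TensorProduct.assoc k H H H).symm ((1 : H) ⊗ₜ[k] X) * (E ⊗ₜ[k] (1 : H))) =
      ((TensorProduct.rid k H).toLinearMap ∘ₗ (counit (R := k) (A := H)).lTensor H ∘ₗ
        LinearMap.mulRight k E ∘ₗ TensorProduct.mk k H H 1).rTensor H X := by
    induction X with
    | zero => simp
    | add a b ha hb => simp only [map_add, ha, hb, tmul_add, add_mul]
    | tmul a b =>
      induction E with
      | zero => simp
      | add c d hc hd =>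
        simp only [add_tmul, map_add, hc, hd, mul_add, LinearMap.rTensor_tmul,
          LinearMap.comp_apply, LinearMap.mulRight_apply]
      | tmul c d => simp
  have h1 : (((1 : H) ⊗ₜ[k] h) * comul (1 : H)) =
      ((TensorProduct.rid k H).toLinearMap ∘ₗ counit.lTensor H).rTensor H
        ((TensorProduct.assoc k H H H).symm (comul.lTensor H (((1 : H) ⊗ₜ[k] h) * comul 1))) := by
    have (x : H ⊗[k] H) : ((TensorProduct.rid k H).toLinearMap ∘ₗ counit.lTensor H).rTensor H
        ((TensorProduct.assoc k H H H).symm (comul.lTensor H x)) = x := by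
      induction x with
      | zero => simp
      | add a b ha hb => simp only [map_add, ha, hb]
      | tmul a b =>
        rw [LinearMap.lTensor_tmul]
        let r := Repr.arbitrary k b
        have : (((TensorProduct.rid k H).toLinearMap ∘ₗ counit.lTensor H).rTensor H)
            ((TensorProduct.assoc k H H H).symm (a ⊗ₜ[k] comul b)) =
            a ⊗ₜ ∑ i ∈ r.index, counit (R := k) (r.left i) • r.right i := by
          rw [← r.eq]
          simp [tmul_sum, smul_tmul]
        rw [this, Coalgebra.sum_counit_smul]
    exact (this _).symm
  have h2 (x : H ⊗[k] H) : (TensorProduct.assoc k H H H).symm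
      (comul.lTensor H (((1 : H) ⊗ₜ[k] h) * x)) =
      (TensorProduct.assoc k H H H).symm ((1 : H) ⊗ₜ[k] comul h) *
        (TensorProduct.assoc k H H H).symm (comul.lTensor H x) := by
    induction x with
    | zero => simp
    | add a b ha hb => simp only [map_add, ha, hb, mul_add]
    | tmul a b =>
      rw [Algebra.TensorProduct.tmul_mul_tmul, LinearMap.lTensor_tmul, LinearMap.lTensor_tmul,
        comul_mul]
      rw [← (Repr.arbitrary k h).eq, ← (Repr.arbitrary k b).eq]
      simp [Finset.sum_mul_sum, tmul_sum]
  have h3 : (TensorProduct.assoc k H H H).symm ((1 : H) ⊗ₜ[k] comul h) *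
      (TensorProduct.assoc k H H H).symm ((1 : H) ⊗ₜ[k] comul (1 : H)) =
      (TensorProduct.assoc k H H H).symm ((1 : H) ⊗ₜ[k] comul h) := by
    conv_rhs => rw [← comul_mul_one]
    rw [← (Repr.arbitrary k h).eq, ← (Repr.arbitrary k (1 : H)).eq]
    simp [Finset.sum_mul_sum, tmul_sum]
  rw [h1, h2, coassoc_symm_apply, comul_comul_one', ← mul_assoc, h3, key]
  rfl

end Counital

/-! ### The bases `H_t` and `H_s` -/

section Bases

variable {k H : Type*} [Field k] [Ring H] [WeakHopfAlgebra k H]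

/-- `Δ(ε_t(h)) = ε(1₁ h) 1₂ ⊗ 1₃`. -/
theorem comul_counitalTarget_eq_contract (h : H) :
    comul (R := k) (counitalTarget k h) =
      ((TensorProduct.lid k (H ⊗[k] H)).toLinearMap ∘ₗ
        (counit ∘ₗ LinearMap.mulRight k h).rTensor (H ⊗[k] H) ∘ₗ
          (TensorProduct.assoc k H H H).toLinearMap) (comul.rTensor H (comul (1 : H))) := by
  let r := Repr.arbitrary k (1 : H)
  rw [counitalTarget_apply h r]
  simp only [LinearMap.comp_apply, LinearEquiv.coe_coe, coassoc_apply]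
  rw [← r.eq]
  simp

/-- `Δ(ε_s(h)) = 1₁ ⊗ 1₂ ε(h 1₃)`. -/
theorem comul_counitalSource_eq_contract (h : H) :
    comul (R := k) (counitalSource k h) =
      ((TensorProduct.rid k (H ⊗[k] H)).toLinearMap ∘ₗ
        (counit ∘ₗ LinearMap.mulLeft k h).lTensor (H ⊗[k] H))
          (comul.rTensor H (comul (1 : H))) := by
  let r := Repr.arbitrary k (1 : H)
  rw [counitalSource_apply h r, ← r.eq]
  simp

theorem comul_counitalTarget (h : H) : comul (R := k) (counitalTarget k h) =
    comul (1 : H) * (counitalTarget k h ⊗ₜ[k] (1 : H)) := by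
  have key (E F : H ⊗[k] H) : ((TensorProduct.lid k (H ⊗[k] H)).toLinearMap ∘ₗ
        (counit ∘ₗ LinearMap.mulRight k h).rTensor (H ⊗[k] H) ∘ₗ
          (TensorProduct.assoc k H H H).toLinearMap)
          ((TensorProduct.assoc k H H H).symm ((1 : H) ⊗ₜ[k] E) * (F ⊗ₜ[k] (1 : H))) =
        E * ((TensorProduct.lid k H (counit.rTensor H (F * h ⊗ₜ[k] (1 : H)))) ⊗ₜ[k] (1 : H)) := by
    induction F with
    | zero => simp
    | add a b ha hb => simp only [map_add, ha, hb, add_tmul, mul_add, add_mul]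
    | tmul a b =>
      induction E with
      | zero => simp
      | add c d hc hd => simp only [tmul_add, map_add, hc, hd, add_mul]
      | tmul c d => simp [smul_tmul]
  rw [comul_counitalTarget_eq_contract, comul_comul_one', key]
  rfl

theorem comul_counitalTarget' (h : H) : comul (R := k) (counitalTarget k h) =
    (counitalTarget k h ⊗ₜ[k] (1 : H)) * comul (1 : H) := by
  have key (E F : H ⊗[k] H) : ((TensorProduct.lid k (H ⊗[k] H)).toLinearMap ∘ₗ
        (counit ∘ₗ LinearMap.mulRight k h).rTensor (H ⊗[k] H) ∘ₗ
          (TensorProduct.assoc k H H H).toLinearMap)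
          ((F ⊗ₜ[k] (1 : H)) * (TensorProduct.assoc k H H H).symm ((1 : H) ⊗ₜ[k] E)) =
        ((TensorProduct.lid k H (counit.rTensor H (F * h ⊗ₜ[k] (1 : H)))) ⊗ₜ[k] (1 : H)) * E := by
    induction F with
    | zero => simp
    | add a b ha hb => simp only [map_add, ha, hb, add_tmul, add_mul]
    | tmul a b =>
      induction E with
      | zero => simp
      | add c d hc hd => simp only [tmul_add, map_add, hc, hd, mul_add]
      | tmul c d => simp [smul_tmul]
  rw [comul_counitalTarget_eq_contract, comul_comul_one, key]
  rfl

theorem comul_counitalSource (h : H) : comul (R := k) (counitalSource k h) =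
    comul (1 : H) * ((1 : H) ⊗ₜ[k] counitalSource k h) := by
  have key (E F : H ⊗[k] H) : ((TensorProduct.rid k (H ⊗[k] H)).toLinearMap ∘ₗ
        (counit ∘ₗ LinearMap.mulLeft k h).lTensor (H ⊗[k] H))
          ((E ⊗ₜ[k] (1 : H)) * (TensorProduct.assoc k H H H).symm ((1 : H) ⊗ₜ[k] F)) =
        E * ((1 : H) ⊗ₜ[k] (TensorProduct.rid k H (counit.lTensor H ((1 : H) ⊗ₜ[k] h * F)))) := by
    induction F with
    | zero => simp
    | add a b ha hb => simp only [map_add, ha, hb, tmul_add, mul_add]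
    | tmul a b =>
      induction E with
      | zero => simp
      | add c d hc hd => simp only [add_tmul, map_add, hc, hd, add_mul]
      | tmul c d => simp
  rw [comul_counitalSource_eq_contract, comul_comul_one, key]
  rfl

theorem comul_counitalSource' (h : H) : comul (R := k) (counitalSource k h) =
    ((1 : H) ⊗ₜ[k] counitalSource k h) * comul (1 : H) := by
  have key (E F : H ⊗[k] H) : ((TensorProduct.rid k (H ⊗[k] H)).toLinearMap ∘ₗ
        (counit ∘ₗ LinearMap.mulLeft k h).lTensor (H ⊗[k] H))
          ((TensorProduct.assoc k H H H).symm ((1 : H) ⊗ₜ[k] F) * (E ⊗ₜ[k] (1 : H))) =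
        ((1 : H) ⊗ₜ[k] (TensorProduct.rid k H (counit.lTensor H ((1 : H) ⊗ₜ[k] h * F)))) * E := by
    induction F with
    | zero => simp
    | add a b ha hb => simp only [map_add, ha, hb, tmul_add, mul_add, add_mul]
    | tmul a b =>
      induction E with
      | zero => simp
      | add c d hc hd => simp only [add_tmul, map_add, hc, hd, mul_add]
      | tmul c d => simp
  rw [comul_counitalSource_eq_contract, comul_comul_one', key]
  rfl

theorem comul_target_mul {z : H} (hz : z ∈ targetBase k H) (h : H) :
    comul (R := k) (z * h) = (z ⊗ₜ[k] (1 : H)) * comul h := by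
  obtain ⟨g, rfl⟩ := hz
  rw [comul_mul, comul_counitalTarget', mul_assoc, one_mul_comul]

theorem comul_mul_target {z : H} (hz : z ∈ targetBase k H) (h : H) :
    comul (R := k) (h * z) = comul h * (z ⊗ₜ[k] (1 : H)) := by
  obtain ⟨g, rfl⟩ := hz
  rw [comul_mul, comul_counitalTarget, ← mul_assoc, comul_mul_one]

theorem comul_source_mul {y : H} (hy : y ∈ sourceBase k H) (h : H) :
    comul (R := k) (y * h) = ((1 : H) ⊗ₜ[k] y) * comul h := by
  obtain ⟨g, rfl⟩ := hy
  rw [comul_mul, comul_counitalSource', mul_assoc, one_mul_comul]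

theorem comul_mul_source {y : H} (hy : y ∈ sourceBase k H) (h : H) :
    comul (R := k) (h * y) = comul h * ((1 : H) ⊗ₜ[k] y) := by
  obtain ⟨g, rfl⟩ := hy
  rw [comul_mul, comul_counitalSource, ← mul_assoc, comul_mul_one]

theorem counit_mul_counitalTarget (g h : H) :
    counit (R := k) (g * counitalTarget k h) = counit (R := k) (g * h) := by
  let r := Repr.arbitrary k (1 : H)
  have := counit_mul_mul' (k := k) g 1 h
  rw [mul_one] at this
  rw [this, counitalTarget_apply h r, ← r.eq]
  simp [Finset.mul_sum]

theorem counit_counitalSource_mul (g h : H) :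
    counit (R := k) (counitalSource k g * h) = counit (R := k) (g * h) := by
  let r := Repr.arbitrary k (1 : H)
  have := counit_mul_mul' (k := k) g 1 h
  rw [mul_one] at this
  rw [this, counitalSource_apply g r, ← r.eq]
  simp [Finset.sum_mul, mul_comm]

theorem counit_mul_counitalSourceOp (g h : H) :
    counit (R := k) (g * counitalSourceOp k h) = counit (R := k) (g * h) := by
  let r := Repr.arbitrary k (1 : H)
  have := counit_mul_mul (k := k) g 1 h
  rw [mul_one] at this
  rw [this, counitalSourceOp_apply h r, ← r.eq]
  simp [Finset.mul_sum, mul_comm]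

theorem counit_counitalTargetOp_mul (g h : H) :
    counit (R := k) (counitalTargetOp k g * h) = counit (R := k) (g * h) := by
  let r := Repr.arbitrary k (1 : H)
  have := counit_mul_mul (k := k) g 1 h
  rw [mul_one] at this
  rw [this, counitalTargetOp_apply g r, ← r.eq]
  simp [Finset.sum_mul]

theorem counitalTarget_congr {g h : H}
    (H1 : ∀ x : H, counit (R := k) (x * g) = counit (R := k) (x * h)) :
    counitalTarget k g = counitalTarget k h := by
  rw [counitalTarget_apply _ (Repr.arbitrary k 1), counitalTarget_apply _ (Repr.arbitrary k 1)]
  simp only [H1]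

theorem counitalSource_congr {g h : H}
    (H1 : ∀ x : H, counit (R := k) (g * x) = counit (R := k) (h * x)) :
    counitalSource k g = counitalSource k h := by
  rw [counitalSource_apply _ (Repr.arbitrary k 1), counitalSource_apply _ (Repr.arbitrary k 1)]
  simp only [H1]

theorem counitalTarget_mul_counitalTarget (g h : H) :
    counitalTarget k (g * counitalTarget k h) = counitalTarget k (g * h) :=
  counitalTarget_congr fun x => by rw [← mul_assoc, counit_mul_counitalTarget, mul_assoc]

theorem counitalSource_counitalSource_mul (g h : H) :
    counitalSource k (counitalSource k g * h) = counitalSource k (g * h) :=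
  counitalSource_congr fun x => by rw [mul_assoc, counit_counitalSource_mul, mul_assoc]

theorem counitalTarget_counitalSourceOp (h : H) :
    counitalTarget k (counitalSourceOp k h) = counitalTarget k h :=
  counitalTarget_congr fun x => counit_mul_counitalSourceOp x h

theorem counitalSource_counitalTargetOp (h : H) :
    counitalSource k (counitalTargetOp k h) = counitalSource k h :=
  counitalSource_congr fun x => counit_counitalTargetOp_mul h x

theorem counitalTarget_of_mem {z : H} (hz : z ∈ targetBase k H) : counitalTarget k z = z := by
  have := congrArg ((TensorProduct.lid k H).toLinearMap ∘ₗ (counit (R := k)).rTensor H)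
    (comul_mul_target hz 1)
  rw [one_mul] at this
  simp only [LinearMap.comp_apply, rTensor_counit_comul, LinearEquiv.coe_coe,
    TensorProduct.lid_tmul, one_smul] at this
  exact this.symm

theorem counitalSource_of_mem {y : H} (hy : y ∈ sourceBase k H) : counitalSource k y = y := by
  have := congrArg ((TensorProduct.rid k H).toLinearMap ∘ₗ (counit (R := k)).lTensor H)
    (comul_source_mul hy 1)
  rw [mul_one] at this
  simp only [LinearMap.comp_apply, lTensor_counit_comul, LinearEquiv.coe_coe,
    TensorProduct.rid_tmul, one_smul] at this
  exact this.symm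

theorem counitalTarget_mem (h : H) : counitalTarget k h ∈ targetBase k H := ⟨h, rfl⟩

theorem counitalSource_mem (h : H) : counitalSource k h ∈ sourceBase k H := ⟨h, rfl⟩

theorem counitalTarget_one : counitalTarget k (1 : H) = 1 := by
  rw [counitalTarget_apply _ (Repr.arbitrary k 1)]
  simpa using Coalgebra.sum_counit_smul (R := k) (Repr.arbitrary k (1 : H))

theorem counitalSource_one : counitalSource k (1 : H) = 1 := by
  rw [counitalSource_apply _ (Repr.arbitrary k 1)]
  simpa using sum_counit_smul_right (k := k) (1 : H) (Repr.arbitrary k (1 : H))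

theorem one_mem_targetBase : (1 : H) ∈ targetBase k H := ⟨1, counitalTarget_one⟩

theorem one_mem_sourceBase : (1 : H) ∈ sourceBase k H := ⟨1, counitalSource_one⟩

/-- `H_t` and `H_s` commute. -/
theorem commute_target_source {z y : H} (hz : z ∈ targetBase k H) (hy : y ∈ sourceBase k H) :
    z * y = y * z := by
  obtain ⟨h, rfl⟩ := hz
  obtain ⟨g, rfl⟩ := hy
  let r := Repr.arbitrary k (1 : H)
  have key := (comul_comul_one (H := H) k).symm.trans (comul_comul_one' k)
  rw [← r.eq] at key
  -- both sides arise from `a ⊗ b ⊗ c ↦ ε(a h) ε(g c) b`, applied to the two expressions of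
  -- `Δ²(1)` as products of `Δ(1) ⊗ 1` and `1 ⊗ Δ(1)`
  have key2 := congrArg ((TensorProduct.rid k H).toLinearMap ∘ₗ
    TensorProduct.map ((TensorProduct.lid k H).toLinearMap ∘ₗ
      (counit (R := k) ∘ₗ LinearMap.mulRight k h).rTensor H)
      (counit (R := k) ∘ₗ LinearMap.mulLeft k g)) key
  rw [counitalTarget_apply h r, counitalSource_apply g r]
  simp only [sum_tmul, tmul_sum, map_sum, Finset.sum_mul_sum, TensorProduct.assoc_symm_tmul,
    Algebra.TensorProduct.tmul_mul_tmul, one_mul, mul_one, LinearMap.comp_apply,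
    LinearEquiv.coe_coe, TensorProduct.map_tmul, LinearMap.rTensor_tmul, LinearMap.mulRight_apply,
    LinearMap.mulLeft_apply, TensorProduct.lid_tmul,
    TensorProduct.rid_tmul] at key2
  simp only [Finset.sum_mul_sum, smul_mul_smul_comm]
  refine Eq.trans ?_ (key2.trans ?_)
  · refine Finset.sum_congr rfl fun i _ => Finset.sum_congr rfl fun j _ => ?_
    rw [smul_smul, mul_comm]
  · refine Finset.sum_congr rfl fun i _ => Finset.sum_congr rfl fun j _ => ?_
    rw [smul_smul]

end Bases

/-! ### Convolution -/

section Convolution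

variable {k C A : Type*} [Field k] [AddCommGroup C] [Module k C] [Coalgebra k C] [Ring A]
  [Algebra k A]

/-- The convolution `h ↦ f(h₁) g(h₂)` of two linear maps from a coalgebra to an algebra. -/
noncomputable def convolution (f g : C →ₗ[k] A) : C →ₗ[k] A :=
  LinearMap.mul' k A ∘ₗ TensorProduct.map f g ∘ₗ comul

theorem convolution_apply (f g : C →ₗ[k] A) (c : C) {ι : Type*} (r : Repr k c ι) :
    convolution f g c = ∑ i ∈ r.index, f (r.left i) * g (r.right i) := by
  simp [convolution, ← r.eq]

theorem convolution_assoc (f g h : C →ₗ[k] A) :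
    convolution (convolution f g) h = convolution f (convolution g h) :=
  congrArg WithConv.ofConv
    (mul_assoc (WithConv.toConv f) (WithConv.toConv g) (WithConv.toConv h))

end Convolution

/-! ### Antimultiplicativity of the antipode -/

section Antipode

variable {k H : Type*} [Field k] [Ring H] [WeakHopfAlgebra k H]

theorem convolution_id_antipode :
    convolution (LinearMap.id (R := k) (M := H)) (antipode k) = counitalTarget k :=
  LinearMap.ext mul_antipode

theorem convolution_antipode_id :
    convolution (antipode k) (LinearMap.id (R := k) (M := H)) = counitalSource k :=
  LinearMap.ext antipode_mul

theorem convolution_antipode_counitalTarget :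
    convolution (antipode k) (counitalTarget k) = antipode k (H := H) := by
  rw [← convolution_id_antipode]
  exact LinearMap.ext antipode_mul_antipode

theorem convolution_counitalSource_antipode :
    convolution (counitalSource k) (antipode k) = antipode k (H := H) := by
  rw [← convolution_antipode_id, convolution_assoc, convolution_id_antipode,
    convolution_antipode_counitalTarget]

theorem counitalTarget_eq_sum (h : H) {ι : Type*} (r : Repr k h ι) :
    counitalTarget k h = ∑ i ∈ r.index, r.left i * antipode k (r.right i) := by
  rw [← convolution_id_antipode, convolution_apply _ _ _ r]; rfl

theorem counitalSource_eq_sum (h : H) {ι : Type*} (r : Repr k h ι) :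
    counitalSource k h = ∑ i ∈ r.index, antipode k (r.left i) * r.right i := by
  rw [← convolution_antipode_id, convolution_apply _ _ _ r]; rfl

theorem counitalTarget_target_mul {z : H} (hz : z ∈ targetBase k H) (h : H) :
    counitalTarget k (z * h) = z * counitalTarget k h := by
  rw [counitalTarget_eq_sum h (Repr.arbitrary k h), ← mul_antipode, comul_target_mul hz,
    ← (Repr.arbitrary k h).eq]
  simp [Finset.mul_sum, mul_assoc]

theorem counitalSource_mul_source {y : H} (hy : y ∈ sourceBase k H) (h : H) :
    counitalSource k (h * y) = counitalSource k h * y := by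
  rw [counitalSource_eq_sum h (Repr.arbitrary k h), ← antipode_mul, comul_mul_source hy,
    ← (Repr.arbitrary k h).eq]
  simp [Finset.sum_mul, mul_assoc]

theorem counitalTarget_mul_target {z : H} (hz : z ∈ targetBase k H) (h : H) {ι : Type*}
    (r : Repr k h ι) :
    counitalTarget k (h * z) = ∑ i ∈ r.index, r.left i * z * antipode k (r.right i) := by
  rw [← mul_antipode, comul_mul_target hz, ← r.eq]
  simp [Finset.sum_mul]

theorem counitalSource_source_mul {y : H} (hy : y ∈ sourceBase k H) (h : H) {ι : Type*}
    (r : Repr k h ι) :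
    counitalSource k (y * h) = ∑ i ∈ r.index, antipode k (r.left i) * (y * r.right i) := by
  rw [← antipode_mul, comul_source_mul hy, ← r.eq]
  simp [Finset.mul_sum]

theorem mul_mem_sourceBase {y x : H} (hy : y ∈ sourceBase k H) (hx : x ∈ sourceBase k H) :
    y * x ∈ sourceBase k H :=
  ⟨y * x, by rw [counitalSource_mul_source hx, counitalSource_of_mem hy]⟩

theorem lTensor_tmul_one_mul (f : H →ₗ[k] H) (a : H) (x : H ⊗[k] H) :
    f.lTensor H ((a ⊗ₜ[k] (1 : H)) * x) = (a ⊗ₜ[k] (1 : H)) * f.lTensor H x := by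
  induction x with
  | zero => simp
  | add a b ha hb => simp only [mul_add, map_add, ha, hb]
  | tmul a b => simp

theorem rTensor_one_tmul_mul (f : H →ₗ[k] H) (a : H) (x : H ⊗[k] H) :
    f.rTensor H (((1 : H) ⊗ₜ[k] a) * x) = ((1 : H) ⊗ₜ[k] a) * f.rTensor H x := by
  induction x with
  | zero => simp
  | add a b ha hb => simp only [mul_add, map_add, ha, hb]
  | tmul a b => simp

theorem lTensor_counitalTarget_one :
    (counitalTarget k).lTensor H (comul (R := k) (1 : H)) = comul (1 : H) := by
  rw [lTensor_counitalTarget_comul, ← Algebra.TensorProduct.one_def, mul_one]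

theorem rTensor_counitalSource_one :
    (counitalSource k).rTensor H (comul (R := k) (1 : H)) = comul (1 : H) := by
  rw [rTensor_counitalSource_comul, ← Algebra.TensorProduct.one_def, one_mul]

theorem antipode_target {z : H} (hz : z ∈ targetBase k H) :
    antipode k z = counitalSource k z := by
  have h1 : comul (R := k) z = (z ⊗ₜ[k] (1 : H)) * comul (1 : H) := by
    simpa using comul_target_mul hz 1
  have h2 : (counitalTarget k).lTensor H (comul (R := k) z) = comul z := by
    rw [h1, lTensor_tmul_one_mul, lTensor_counitalTarget_one]
  calc antipode k z = convolution (antipode k) (counitalTarget k) z := by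
        rw [convolution_antipode_counitalTarget]
    _ = LinearMap.mul' k H ((antipode k).rTensor H
          ((counitalTarget k).lTensor H (comul (R := k) z))) := by
        rw [← LinearMap.comp_apply (LinearMap.rTensor H _), LinearMap.rTensor_comp_lTensor]; rfl
    _ = counitalSource k z := by rw [h2, antipode_mul]

theorem antipode_source {y : H} (hy : y ∈ sourceBase k H) :
    antipode k y = counitalTarget k y := by
  have h1 : comul (R := k) y = ((1 : H) ⊗ₜ[k] y) * comul (1 : H) := by
    simpa using comul_source_mul hy 1
  have h2 : (counitalSource k).rTensor H (comul (R := k) y) = comul y := by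
    rw [h1, rTensor_one_tmul_mul, rTensor_counitalSource_one]
  calc antipode k y = convolution (counitalSource k) (antipode k) y := by
        rw [convolution_counitalSource_antipode]
    _ = LinearMap.mul' k H ((antipode k).lTensor H
          ((counitalSource k).rTensor H (comul (R := k) y))) := by
        rw [← LinearMap.comp_apply (LinearMap.lTensor H _), LinearMap.lTensor_comp_rTensor]; rfl
    _ = counitalTarget k y := by rw [h2, mul_antipode]

theorem antipode_one : antipode k (1 : H) = 1 := by
  rw [antipode_target one_mem_targetBase, counitalSource_one]

theorem antipode_target_mem {z : H} (hz : z ∈ targetBase k H) : antipode k z ∈ sourceBase k H := by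
  rw [antipode_target hz]; exact counitalSource_mem z

theorem antipode_source_mem {y : H} (hy : y ∈ sourceBase k H) : antipode k y ∈ targetBase k H := by
  rw [antipode_source hy]; exact counitalTarget_mem y

/-- `S(g₁) ε_t(g₂ z) = z S(g)` for `z ∈ H_t`. -/
theorem convolution_antipode_mul_target {z : H} (hz : z ∈ targetBase k H) (g : H) :
    convolution (antipode k) (counitalTarget k ∘ₗ LinearMap.mulRight k z) g =
      z * antipode k g := by
  have h1 : counitalTarget k ∘ₗ LinearMap.mulRight k z =
      convolution (LinearMap.mulRight k z) (antipode k) := by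
    ext h
    rw [convolution_apply _ _ _ (Repr.arbitrary k h)]
    exact counitalTarget_mul_target hz h _
  have h2 : convolution (antipode k) (LinearMap.mulRight k z) =
      LinearMap.mulRight k z ∘ₗ counitalSource k := by
    ext h
    rw [convolution_apply _ _ _ (Repr.arbitrary k h), LinearMap.comp_apply,
      counitalSource_eq_sum h (Repr.arbitrary k h)]
    simp [mul_assoc]
  rw [h1, ← convolution_assoc, h2, convolution_apply _ _ _ (Repr.arbitrary k g),
    ← convolution_counitalSource_antipode (k := k), convolution_apply _ _ g (Repr.arbitrary k g),
    Finset.mul_sum]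
  refine Finset.sum_congr rfl fun i _ => ?_
  rw [convolution_counitalSource_antipode, LinearMap.comp_apply, LinearMap.mulRight_apply,
    ← commute_target_source hz (counitalSource_mem _), mul_assoc]

/-- The comultiplication of `g ⊗ h` in the tensor product coalgebra. -/
noncomputable def tmulRepr {g h : H} {ι κ : Type*} (r : Repr k g ι) (s : Repr k h κ) :
    Repr k (g ⊗ₜ[k] h) (ι × κ) where
  index := r.index ×ˢ s.index
  left p := r.left p.1 ⊗ₜ s.left p.2
  right p := r.right p.1 ⊗ₜ s.right p.2
  eq := by
    rw [TensorProduct.comul_tmul, ← r.eq, ← s.eq, sum_tmul, map_sum, Finset.sum_product]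
    refine Finset.sum_congr rfl fun i _ => ?_
    rw [tmul_sum, map_sum]
    rfl

theorem comul_mul_repr {g h : H} {ι κ : Type*} (r : Repr k g ι) (s : Repr k h κ) :
    comul (R := k) (g * h) = ∑ i ∈ r.index, ∑ j ∈ s.index,
      (r.left i * s.left j) ⊗ₜ[k] (r.right i * s.right j) := by
  rw [comul_mul, ← r.eq, ← s.eq, Finset.sum_mul_sum]
  simp

/-- The antipode is antimultiplicative: in the convolution algebra of maps `H ⊗ H → H`, both
`g ⊗ h ↦ S(gh)` and `g ⊗ h ↦ S(h)S(g)` are generalized inverses of the multiplication, with the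
same left and right supports. -/
theorem antipode_mul_rev (g h : H) : antipode k (g * h) = antipode k h * antipode k g := by
  let m : H ⊗[k] H →ₗ[k] H := LinearMap.mul' k H
  let a : H ⊗[k] H →ₗ[k] H := antipode k ∘ₗ LinearMap.mul' k H
  let b : H ⊗[k] H →ₗ[k] H := LinearMap.mul' k H ∘ₗ TensorProduct.map (antipode k) (antipode k) ∘ₗ
    (TensorProduct.comm k H H).toLinearMap
  have ham (g h : H) : convolution a m (g ⊗ₜ h) = counitalSource k (g * h) := by
    let r := Repr.arbitrary k g
    let s := Repr.arbitrary k h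
    rw [convolution_apply _ _ _ (tmulRepr r s), ← antipode_mul, comul_mul_repr r s]
    simp [tmulRepr, Finset.sum_product, a, m]
  have hma (g h : H) : convolution m a (g ⊗ₜ h) = counitalTarget k (g * h) := by
    let r := Repr.arbitrary k g
    let s := Repr.arbitrary k h
    rw [convolution_apply _ _ _ (tmulRepr r s), ← mul_antipode, comul_mul_repr r s]
    simp [tmulRepr, Finset.sum_product, a, m]
  have hbm (g h : H) : convolution b m (g ⊗ₜ h) = counitalSource k (g * h) := by
    let r := Repr.arbitrary k g
    let s := Repr.arbitrary k h
    rw [convolution_apply _ _ _ (tmulRepr r s), ← counitalSource_counitalSource_mul,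
      counitalSource_source_mul (counitalSource_mem g) h s, counitalSource_eq_sum g r]
    simp [tmulRepr, Finset.sum_product, b, m]
    rw [Finset.sum_comm]
    simp [Finset.sum_mul, Finset.mul_sum, mul_assoc]
  -- `a * m * a = a`, from `S = ε_s * S` on `H`
  have haa : convolution (convolution a m) a = a := by
    refine TensorProduct.ext' fun g h => ?_
    let r := Repr.arbitrary k g
    let s := Repr.arbitrary k h
    change _ = antipode k (g * h)
    rw [← convolution_counitalSource_antipode (k := k), convolution_apply _ _ _ (tmulRepr r s)]
    simp only [convolution, LinearMap.comp_apply, comul_mul_repr r s]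
    simp only [map_sum, TensorProduct.map_tmul, LinearMap.mul'_apply]
    simp only [tmulRepr, Finset.sum_product]
    refine Finset.sum_congr rfl fun i _ => Finset.sum_congr rfl fun j _ => ?_
    exact congrArg₂ (· * ·) (ham _ _) rfl
  -- `b * m * a = b`, by moving `ε_t(g₂ ε_t(h₂))` past the antipodes
  have hba : convolution b (convolution m a) = b := by
    refine TensorProduct.ext' fun g h => ?_
    let r := Repr.arbitrary k g
    let s := Repr.arbitrary k h
    change _ = antipode k h * antipode k g
    rw [convolution_apply _ _ _ (tmulRepr r s)]
    conv_rhs => rw [← convolution_antipode_counitalTarget (k := k),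
      convolution_apply _ _ h s, Finset.sum_mul]
    simp only [tmulRepr, Finset.sum_product]
    rw [Finset.sum_comm]
    refine Finset.sum_congr rfl fun j _ => ?_
    rw [mul_assoc, convolution_antipode_counitalTarget,
      ← convolution_antipode_mul_target (counitalTarget_mem _) g, convolution_apply _ _ g r,
      Finset.mul_sum]
    refine Finset.sum_congr rfl fun i _ => ?_
    rw [hma]
    simp [b, counitalTarget_mul_counitalTarget, mul_assoc]
  have hab : convolution a m = convolution b m :=
    TensorProduct.ext' fun g h => (ham g h).trans (hbm g h).symm
  have : a = b := by rw [← haa, hab, convolution_assoc, hba]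
  exact congrArg (fun f => f (g ⊗ₜ h)) this

theorem counitalSourceOp_mem (h : H) : counitalSourceOp k h ∈ sourceBase k H := by
  refine ⟨counitalSourceOp k h, ?_⟩
  have := congrArg ((TensorProduct.rid k H).toLinearMap ∘ₗ
    (counit (R := k) ∘ₗ LinearMap.mulRight k h).lTensor H) (rTensor_counitalSource_one (k := k))
  rw [counitalSourceOp_apply h (Repr.arbitrary k 1)]
  rw [← (Repr.arbitrary k (1 : H)).eq] at this
  simpa using this

theorem counitalTargetOp_mem (h : H) : counitalTargetOp k h ∈ targetBase k H := by
  refine ⟨counitalTargetOp k h, ?_⟩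
  have := congrArg ((TensorProduct.lid k H).toLinearMap ∘ₗ
    (counit (R := k) ∘ₗ LinearMap.mulLeft k h).rTensor H) (lTensor_counitalTarget_one (k := k))
  rw [counitalTargetOp_apply h (Repr.arbitrary k 1)]
  rw [← (Repr.arbitrary k (1 : H)).eq] at this
  simpa using this

theorem antipode_counitalSourceOp (h : H) :
    antipode k (counitalSourceOp k h) = counitalTarget k h := by
  rw [antipode_source (counitalSourceOp_mem h), counitalTarget_counitalSourceOp]

theorem antipode_counitalTargetOp (h : H) :
    antipode k (counitalTargetOp k h) = counitalSource k h := by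
  rw [antipode_target (counitalTargetOp_mem h), counitalSource_counitalTargetOp]

/-- `h₁ ⊗ ε_s(h₂) = h 1₁ ⊗ S(1₂)`. -/
theorem lTensor_counitalSource_comul (h : H) :
    (counitalSource k).lTensor H (comul (R := k) h) =
      (h ⊗ₜ[k] (1 : H)) * (antipode k).lTensor H (comul (1 : H)) := by
  rw [← lTensor_tmul_one_mul, ← lTensor_counitalTargetOp_comul,
    ← LinearMap.lTensor_comp_apply]
  congr 2
  exact LinearMap.ext fun x => (antipode_counitalTargetOp x).symm

variable (k H) in
/-- An expansion of `Δ(1)` with first legs in `H_s` and second legs in `H_t`. -/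
noncomputable def baseRepr : Repr k (1 : H) (H × H) where
  index := (Repr.arbitrary k (1 : H)).index
  left i := counitalSource k ((Repr.arbitrary k (1 : H)).left i)
  right i := counitalTarget k ((Repr.arbitrary k (1 : H)).right i)
  eq := by
    conv_rhs => rw [← lTensor_counitalTarget_one, ← rTensor_counitalSource_one,
      ← (Repr.arbitrary k (1 : H)).eq]
    simp

theorem baseRepr_left_mem (i : H × H) : (baseRepr k H).left i ∈ sourceBase k H :=
  counitalSource_mem _

theorem baseRepr_right_mem (i : H × H) : (baseRepr k H).right i ∈ targetBase k H :=
  counitalTarget_mem _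

end Antipode

/-! ### The antipode, the counit and the comultiplication -/

section Duality

variable {k H : Type*} [Field k] [Ring H] [WeakHopfAlgebra k H] [FiniteDimensional k H]

theorem tensor_ext_of_dual {x y : H ⊗[k] H} (hxy : ∀ φ ψ : Module.Dual k H,
    LinearMap.mul' k k (TensorProduct.map φ ψ x) = LinearMap.mul' k k (TensorProduct.map φ ψ y)) :
    x = y := by
  rw [← sub_eq_zero, ← Module.forall_dual_apply_eq_zero_iff k]
  intro f
  obtain ⟨g, rfl⟩ := (TensorProduct.dualDistribEquiv k H H).surjective f
  induction g with
  | zero => simp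
  | add a b ha hb => rw [map_add, LinearMap.add_apply, ha, hb, add_zero]
  | tmul φ ψ =>
    have key (z : H ⊗[k] H) : TensorProduct.dualDistribEquiv k H H (φ ⊗ₜ ψ) z =
        LinearMap.mul' k k (TensorProduct.map φ ψ z) := by
      induction z with
      | zero => simp
      | add a b ha hb => simp only [map_add, ha, hb]
      | tmul a b => rfl
    rw [map_sub, key, key, hxy, sub_self]

/-- This is `S(1) = 1` in `H*`. -/
theorem counit_antipode (h : H) : counit (R := k) (antipode k h) = counit (R := k) h :=
  congrArg (fun φ : WDual k H => φ h) (antipode_one (k := k) (H := WDual k H))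

/-- This is the antimultiplicativity of the antipode of `H*`. -/
theorem comul_antipode (h : H) : comul (R := k) (antipode k h) =
    TensorProduct.comm k H H (TensorProduct.map (antipode k) (antipode k) (comul h)) := by
  refine tensor_ext_of_dual fun φ ψ => ?_
  have := congrArg (fun χ : WDual k H => χ h)
    (antipode_mul_rev (k := k) (WDual.toDual.symm φ) (WDual.toDual.symm ψ))
  refine (Eq.trans ?_ this).trans ?_
  · rfl
  · let r := Repr.arbitrary k h
    rw [WDual.mul_eval _ _ h r, ← r.eq]
    simp only [map_sum, TensorProduct.map_tmul, TensorProduct.comm_tmul, LinearMap.mul'_apply]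
    refine Finset.sum_congr rfl fun i _ => ?_
    exact mul_comm _ _

end Duality

/-! ### Injectivity of the antipode -/

section Bijective

variable {k H : Type*} [Field k] [Ring H] [WeakHopfAlgebra k H]

theorem convolution_id_counitalSource :
    convolution LinearMap.id (counitalSource k) = LinearMap.id (R := k) (M := H) := by
  ext h
  have (x : H ⊗[k] H) : LinearMap.mul' k H ((h ⊗ₜ[k] (1 : H)) * x) =
      h * LinearMap.mul' k H x := by
    induction x with
    | zero => simp
    | add a b ha hb => simp only [map_add, ha, hb, mul_add]
    | tmul a b => simp [mul_assoc]
  change LinearMap.mul' k H ((counitalSource k).lTensor H (comul (R := k) h)) = h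
  rw [lTensor_counitalSource_comul, this, mul_antipode, counitalTarget_one, mul_one]

theorem convolution_counitalTarget_id :
    convolution (counitalTarget k) LinearMap.id = LinearMap.id (R := k) (M := H) := by
  rw [← convolution_id_antipode, convolution_assoc, convolution_antipode_id,
    convolution_id_counitalSource]

theorem algHom_comp_convolution {A : Type*} [Ring A] [Algebra k A] (θ : H →ₐ[k] A)
    (f g : H →ₗ[k] H) : θ.toLinearMap ∘ₗ convolution f g =
      convolution (θ.toLinearMap ∘ₗ f) (θ.toLinearMap ∘ₗ g) := by
  ext h
  rw [LinearMap.comp_apply, convolution_apply _ _ _ (Repr.arbitrary k h),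
    convolution_apply _ _ _ (Repr.arbitrary k h)]
  simp

/-- The antipode is an epimorphism: algebra homomorphisms that agree on its range are equal. This
is `θ(h) = θ(h₁) ρ(S(h₂) h₃) = θ(h₁ S(h₂)) ρ(h₃) = ρ(h)`. -/
theorem algHom_ext_antipode {A : Type*} [Ring A] [Algebra k A] {θ ρ : H →ₐ[k] A}
    (hθρ : ∀ h : H, θ (antipode k h) = ρ (antipode k h)) : θ = ρ := by
  have hS : θ.toLinearMap ∘ₗ antipode k = ρ.toLinearMap ∘ₗ antipode k := LinearMap.ext hθρ
  have hs : θ.toLinearMap ∘ₗ counitalSource k = ρ.toLinearMap ∘ₗ counitalSource k := by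
    ext h
    simpa [antipode_counitalTargetOp] using hθρ (counitalTargetOp k h)
  have ht : θ.toLinearMap ∘ₗ counitalTarget k = ρ.toLinearMap ∘ₗ counitalTarget k := by
    ext h
    simpa [antipode_counitalSourceOp] using hθρ (counitalSourceOp k h)
  suffices θ.toLinearMap = ρ.toLinearMap from AlgHom.toLinearMap_injective this
  calc θ.toLinearMap = θ.toLinearMap ∘ₗ convolution LinearMap.id (counitalSource k) := by
        rw [convolution_id_counitalSource]; rfl
    _ = convolution θ.toLinearMap
          (convolution (ρ.toLinearMap ∘ₗ antipode k) (ρ.toLinearMap ∘ₗ LinearMap.id)) := by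
        rw [algHom_comp_convolution, hs, ← algHom_comp_convolution, convolution_antipode_id]; rfl
    _ = convolution (convolution (θ.toLinearMap ∘ₗ LinearMap.id) (θ.toLinearMap ∘ₗ antipode k))
          (ρ.toLinearMap ∘ₗ LinearMap.id) := by
        rw [← hS, convolution_assoc]; rfl
    _ = ρ.toLinearMap ∘ₗ convolution (counitalTarget k) LinearMap.id := by
        rw [← algHom_comp_convolution, convolution_id_antipode, ht, ← algHom_comp_convolution]
    _ = ρ.toLinearMap := by rw [convolution_counitalTarget_id]; rfl

variable (k H) in
/-- The antipode as an algebra homomorphism to the opposite algebra. -/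
noncomputable def antipodeOp : H →ₐ[k] Hᵐᵒᵖ :=
  AlgHom.ofLinearMap ((MulOpposite.opLinearEquiv k).toLinearMap ∘ₗ antipode k)
    (by simp [antipode_one]) (fun g h => by simp [antipode_mul_rev])

variable (k H) in
/-- The square of the antipode as an algebra endomorphism. -/
noncomputable def antipodeSq : H →ₐ[k] H :=
  AlgHom.ofLinearMap (antipode k ∘ₗ antipode k)
    (by simp [antipode_one]) (fun g h => by simp [antipode_mul_rev])

theorem algHom_ext_antipodeSq {A : Type*} [Ring A] [Algebra k A] {θ ρ : H →ₐ[k] A}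
    (hθρ : ∀ h : H, θ (antipodeSq k H h) = ρ (antipodeSq k H h)) : θ = ρ := by
  have : (AlgHom.op θ).comp (antipodeOp k H) = (AlgHom.op ρ).comp (antipodeOp k H) :=
    algHom_ext_antipode fun h => congrArg MulOpposite.op (hθρ h)
  exact algHom_ext_antipode fun h =>
    congrArg MulOpposite.unop (congrArg (fun f : H →ₐ[k] Aᵐᵒᵖ => f h) this)

theorem algHom_ext_antipodeSq_pow {A : Type*} [Ring A] [Algebra k A] (n : ℕ) {θ ρ : H →ₐ[k] A}
    (hθρ : ∀ h : H, θ ((antipodeSq k H ^ n) h) = ρ ((antipodeSq k H ^ n) h)) : θ = ρ := by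
  induction n generalizing θ ρ with
  | zero => exact AlgHom.ext hθρ
  | succ n ih =>
    have : θ.comp (antipodeSq k H) = ρ.comp (antipodeSq k H) :=
      ih fun h => by rw [pow_succ'] at hθρ; exact hθρ h
    exact algHom_ext_antipodeSq fun h => congrArg (fun f : H →ₐ[k] A => f h) this

/-- The antipode of a finite-dimensional weak Hopf algebra is injective. By Fitting's lemma
`H = ker T ⊕ im T` for a power `T` of `S²`, and the projection to `im T` is an algebra homomorphism
that agrees with the identity on `im T`, hence is the identity. -/
theorem antipode_injective [FiniteDimensional k H] : Function.Injective (antipode k (H := H)) := by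
  obtain ⟨n, hn⟩ := Filter.eventually_atTop.1
    ((antipodeSq k H).toLinearMap.eventually_isCompl_ker_pow_range_pow)
  have hc := hn (n + 1) n.le_succ
  have hpow (m : ℕ) (x : H) : ((antipodeSq k H).toLinearMap ^ m) x = (antipodeSq k H ^ m) x := by
    induction m with
    | zero => rfl
    | succ m ih => rw [pow_succ', pow_succ', Module.End.mul_apply, ih]; rfl
  set T : H →ₐ[k] H := antipodeSq k H ^ (n + 1) with hT
  set L : H →ₗ[k] H := (antipodeSq k H).toLinearMap ^ (n + 1) with hL
  have hLT (x : H) : L x = T x := hpow _ x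
  -- the elements `T u + v` with `T v = 0` form the Fitting decomposition
  have hdec (x : H) : ∃ u v : H, T v = 0 ∧ x = T u + v := by
    obtain ⟨v, hv, w, ⟨u, rfl⟩, rfl⟩ := Submodule.mem_sup.1
      (hc.sup_eq_top ▸ Submodule.mem_top : x ∈ LinearMap.ker L ⊔ LinearMap.range L)
    exact ⟨u, v, by rw [← hLT]; exact hv, by rw [← hLT, add_comm]⟩
  let p : H →ₗ[k] H := L.range.projection L.ker hc.symm
  have hp1 (u : H) : p (T u) = T u := by
    rw [← hLT]
    exact (Submodule.projection_eq_self_iff hc.symm _).2 ⟨u, rfl⟩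
  have hp0 {v : H} (hv : T v = 0) : p v = 0 := by
    rw [← hLT] at hv
    exact (Submodule.projection_apply_eq_zero_iff hc.symm).2 hv
  let π : H →ₐ[k] H := AlgHom.ofLinearMap p (by rw [← map_one T, hp1]) (by
    intro x y
    obtain ⟨u, v, hv, rfl⟩ := hdec x
    obtain ⟨u', v', hv', rfl⟩ := hdec y
    have h1 : T (T u * v' + v * (T u' + v')) = 0 := by simp [hv, hv']
    rw [add_mul, mul_add, add_assoc, map_add, hp0 h1, ← map_mul, hp1, map_add, map_add, hp1, hp1,
      hp0 hv, hp0 hv', map_mul, add_zero, add_zero, add_zero])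
  have hπ : π = AlgHom.id k H := algHom_ext_antipodeSq_pow (n + 1) fun h => hp1 h
  rw [injective_iff_map_eq_zero]
  intro x hx
  have hTx : T x = 0 := by
    rw [hT, pow_succ]
    change (antipodeSq k H ^ n) (antipode k (antipode k x)) = 0
    rw [hx, map_zero, map_zero]
  have := congrArg (fun f : H →ₐ[k] H => f x) hπ
  exact (this.symm.trans (hp0 hTx) : x = 0)

end Bijective

/-! ### Sweedler arrows -/

section Arrows

variable {k C : Type*} [Field k] [AddCommGroup C] [Module k C] [Coalgebra k C]

theorem leftArrow_eq_sum (f : Module.Dual k C) (c : C) {ι : Type*} (r : Repr k c ι) :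
    leftArrow f c = ∑ i ∈ r.index, f (r.right i) • r.left i := by
  simp [leftArrow, ← r.eq]

theorem rightArrow_eq_sum (f : Module.Dual k C) (c : C) {ι : Type*} (r : Repr k c ι) :
    rightArrow c f = ∑ i ∈ r.index, f (r.left i) • r.right i := by
  simp [rightArrow, ← r.eq]

theorem eq_of_forall_dual {V : Type*} [AddCommGroup V] [Module k V] {x y : V}
    (h : ∀ φ : Module.Dual k V, φ x = φ y) : x = y := by
  rw [← sub_eq_zero, ← Module.forall_dual_apply_eq_zero_iff k]
  exact fun φ => by rw [map_sub, h, sub_self]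

end Arrows

/-! ### Non-degenerate functionals -/

section Nondegenerate

variable {k A : Type*} [Field k] [Ring A] [Algebra k A] [FiniteDimensional k A]

theorem exists_eq_mul_left_of_nondegenerate {f : Module.Dual k A}
    (hf : ∀ x : A, (∀ y : A, f (x * y) = 0) → x = 0) (φ : Module.Dual k A) :
    ∃ x : A, ∀ y : A, φ y = f (x * y) := by
  let L : A →ₗ[k] Module.Dual k A := LinearMap.compr₂ (LinearMap.mul k A) f
  have hL : Function.Injective L := (injective_iff_map_eq_zero L).2 fun x hx =>
    hf x fun y => congrArg (fun g : Module.Dual k A => g y) hx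
  obtain ⟨x, hx⟩ := (LinearMap.injective_iff_surjective_of_finrank_eq_finrank
    (Subspace.dual_finrank_eq (K := k) (V := A)).symm).1 hL φ
  exact ⟨x, fun y => congrArg (fun g : Module.Dual k A => g y) hx.symm⟩

theorem exists_eq_mul_right_of_nondegenerate {f : Module.Dual k A}
    (hf : ∀ y : A, (∀ x : A, f (x * y) = 0) → y = 0) (φ : Module.Dual k A) :
    ∃ y : A, ∀ x : A, φ x = f (x * y) := by
  let L : A →ₗ[k] Module.Dual k A := LinearMap.compr₂ (LinearMap.mul k A).flip f
  have hL : Function.Injective L := (injective_iff_map_eq_zero L).2 fun x hx =>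
    hf x fun y => congrArg (fun g : Module.Dual k A => g y) hx
  obtain ⟨x, hx⟩ := (LinearMap.injective_iff_surjective_of_finrank_eq_finrank
    (Subspace.dual_finrank_eq (K := k) (V := A)).symm).1 hL φ
  exact ⟨x, fun y => congrArg (fun g : Module.Dual k A => g y) hx.symm⟩

theorem isNondegenerateFunctional_of_left {f : Module.Dual k A}
    (hf : ∀ x : A, (∀ y : A, f (x * y) = 0) → x = 0) : IsNondegenerateFunctional f := by
  refine ⟨hf, fun y hy => (Module.forall_dual_apply_eq_zero_iff k y).1 fun φ => ?_⟩
  obtain ⟨x, hx⟩ := exists_eq_mul_left_of_nondegenerate hf φ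
  rw [hx, hy]

theorem isNondegenerateFunctional_of_right {f : Module.Dual k A}
    (hf : ∀ y : A, (∀ x : A, f (x * y) = 0) → y = 0) : IsNondegenerateFunctional f := by
  refine ⟨fun x hx => (Module.forall_dual_apply_eq_zero_iff k x).1 fun φ => ?_, hf⟩
  obtain ⟨y, hy⟩ := exists_eq_mul_right_of_nondegenerate hf φ
  rw [hy, hx]

end Nondegenerate

/-! ### Left integrals -/

section Integrals

variable {k H : Type*} [Field k] [Ring H] [WeakHopfAlgebra k H]

theorem leftArrow_target_mul (f : Module.Dual k H) {z : H} (hz : z ∈ targetBase k H) (h : H) :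
    leftArrow f (z * h) = z * leftArrow f h := by
  rw [leftArrow_eq_sum f h (Repr.arbitrary k h), leftArrow, comul_target_mul hz,
    ← (Repr.arbitrary k h).eq]
  simp [Finset.mul_sum]

theorem leftArrow_mul_target (f : Module.Dual k H) {z : H} (hz : z ∈ targetBase k H) (h : H) :
    leftArrow f (h * z) = leftArrow f h * z := by
  rw [leftArrow_eq_sum f h (Repr.arbitrary k h), leftArrow, comul_mul_target hz,
    ← (Repr.arbitrary k h).eq]
  simp [Finset.sum_mul]

theorem counit_leftArrow (f : Module.Dual k H) (h : H) :
    counit (R := k) (leftArrow f h) = f h := by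
  rw [leftArrow_eq_sum f h (Repr.arbitrary k h),
    ← WDual.counit_sum_left f h (Repr.arbitrary k h)]
  simp [mul_comm]

theorem counitalTarget_leftArrow {lam : WDual k H} [FiniteDimensional k H]
    (hl : IsLeftIntegral k lam) (h : H) :
    counitalTarget k (leftArrow (WDual.toDual lam) h) = leftArrow (WDual.toDual lam) h := by
  let r := Repr.arbitrary k h
  refine (eq_of_forall_dual (k := k) fun φ => ?_).symm
  have := congrArg (fun χ : WDual k H => χ h) (hl (WDual.toDual.symm φ))
  rw [WDual.mul_eval _ _ h r, WDual.mul_eval _ _ h r] at this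
  rw [leftArrow_eq_sum _ h r]
  simp only [map_sum, map_smul, smul_eq_mul]
  simp only [WDual.counitalTarget_eval, LinearEquiv.apply_symm_apply] at this
  simpa only [mul_comm] using this

/-- For a left integral `λ` of `H*`, the map `h ↦ λ ⇀ h` is valued in `H_t`. -/
theorem leftArrow_mem_targetBase {lam : WDual k H} [FiniteDimensional k H]
    (hl : IsLeftIntegral k lam) (h : H) : leftArrow (WDual.toDual lam) h ∈ targetBase k H :=
  ⟨_, counitalTarget_leftArrow hl h⟩

/-- `S(h₁)h₂ ⊗ h₃ = ε_s(h₁) ⊗ h₂`. -/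
theorem sum_antipode_mul_comul (h : H) {ι : Type*} (r : Repr k h ι) :
    ∑ i ∈ r.index, (antipode k (r.left i) ⊗ₜ[k] (1 : H)) * comul (R := k) (r.right i) =
      (counitalSource k).rTensor H (comul h) := by
  let F : H ⊗[k] (H ⊗[k] H) →ₗ[k] H ⊗[k] H :=
    (LinearMap.mul' k H ∘ₗ (antipode k).rTensor H).rTensor H ∘ₗ
      (TensorProduct.assoc k H H H).symm.toLinearMap
  have hF (a : H) (x : H ⊗[k] H) : F (a ⊗ₜ x) = (antipode k a ⊗ₜ[k] (1 : H)) * x := by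
    induction x with
    | zero => simp
    | add a b ha hb => simp only [tmul_add, map_add, ha, hb, mul_add]
    | tmul a b => simp [F]
  have h1 : F (comul.lTensor H (comul h)) =
      (LinearMap.mul' k H ∘ₗ (antipode k).rTensor H).rTensor H (comul.rTensor H (comul h)) := by
    simp [F]
  rw [← LinearMap.rTensor_comp_apply] at h1
  have h2 : (LinearMap.mul' k H ∘ₗ (antipode k).rTensor H) ∘ₗ comul =
      counitalSource k (H := H) := LinearMap.ext antipode_mul
  rw [← h2, ← h1, ← r.eq]
  simp [hF]

/-- `ℓ₁ ⊗ hℓ₂ = S(h)ℓ₁ ⊗ ℓ₂` for a left integral `ℓ`. -/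
theorem IsLeftIntegral.tmul_mul_comul {ℓ : H} (hℓ : IsLeftIntegral k ℓ) (h : H) :
    ((1 : H) ⊗ₜ[k] h) * comul (R := k) ℓ = (antipode k h ⊗ₜ[k] (1 : H)) * comul ℓ := by
  let r := Repr.arbitrary k h
  symm
  calc (antipode k h ⊗ₜ[k] (1 : H)) * comul (R := k) ℓ
      = ∑ i ∈ r.index, (antipode k (r.left i) ⊗ₜ[k] (1 : H)) *
          comul (counitalTarget k (r.right i) * ℓ) := by
        conv_lhs => rw [← convolution_antipode_counitalTarget (k := k),
          convolution_apply _ _ h r]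
        simp only [comul_target_mul (counitalTarget_mem _), sum_tmul, Finset.sum_mul,
          ← mul_assoc, Algebra.TensorProduct.tmul_mul_tmul, mul_one]
    _ = (∑ i ∈ r.index, (antipode k (r.left i) ⊗ₜ[k] (1 : H)) * comul (R := k) (r.right i)) *
          comul ℓ := by
        simp only [Finset.sum_mul, ← hℓ _, comul_mul, mul_assoc]
    _ = ((1 : H) ⊗ₜ[k] h) * comul (R := k) ℓ := by
        rw [sum_antipode_mul_comul, rTensor_counitalSource_comul, mul_assoc, one_mul_comul]

theorem IsLeftIntegral.mul_right {ℓ : H} (hℓ : IsLeftIntegral k ℓ) (h : H) :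
    IsLeftIntegral k (ℓ * h) := fun g => by rw [← mul_assoc, hℓ g, mul_assoc]

variable [FiniteDimensional k H] {ℓ : H} {lam : WDual k H}

theorem IsDualPair.apply_mul_target (hd : IsDualPair ℓ lam) {z : H} (hz : z ∈ targetBase k H) :
    lam (ℓ * z) = counit (R := k) z := by
  rw [← counit_leftArrow, leftArrow_mul_target _ hz, hd.2.2, one_mul]

theorem IsDualPair.apply_mul (hd : IsDualPair ℓ lam) (h : H) :
    lam (h * ℓ) = counit (R := k) h := by
  rw [← counit_leftArrow, hd.1 h, leftArrow_target_mul _ (counitalTarget_mem h), hd.2.2, mul_one,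
    ← one_mul (counitalTarget k h), counit_mul_counitalTarget, one_mul]

/-- `S(h) = ℓ₁ λ(h ℓ₂)` for a dual pair `ℓ`, `λ` of left integrals. -/
theorem IsDualPair.leftArrow_mulLeft (hd : IsDualPair ℓ lam) (h : H) :
    leftArrow (WDual.toDual lam ∘ₗ LinearMap.mulLeft k h) ℓ = antipode k h := by
  let r := Repr.arbitrary k ℓ
  have := congrArg ((TensorProduct.rid k H).toLinearMap ∘ₗ (WDual.toDual lam).lTensor H)
    (hd.1.tmul_mul_comul h)
  calc _ = ((TensorProduct.rid k H).toLinearMap ∘ₗ (WDual.toDual lam).lTensor H)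
        (((1 : H) ⊗ₜ[k] h) * comul (R := k) ℓ) := by
        rw [leftArrow_eq_sum _ ℓ r, ← r.eq]
        simp [Finset.mul_sum]
    _ = antipode k h * leftArrow (WDual.toDual lam) ℓ := by
        rw [this, leftArrow_eq_sum _ ℓ r, ← r.eq]
        simp [Finset.mul_sum]
    _ = antipode k h := by rw [hd.2.2, mul_one]

/-- The functional of a dual pair of left integrals is non-degenerate, as the antipode
`S(h) = ℓ₁ λ(h ℓ₂)` is injective. -/
theorem IsDualPair.nondegenerate_functional (hd : IsDualPair ℓ lam) :
    IsNondegenerateFunctional (WDual.toDual lam) := by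
  refine isNondegenerateFunctional_of_left fun x hx => antipode_injective (k := k) ?_
  rw [map_zero, ← hd.leftArrow_mulLeft x]
  have : WDual.toDual lam ∘ₗ LinearMap.mulLeft k x = 0 := LinearMap.ext hx
  rw [this]
  simp [leftArrow]

/-- A functional `ψ = λ(x ·)` with `ℓ₁ ψ(ℓ₂) = 0` has `S(x) = 0`, hence vanishes. -/
theorem IsDualPair.nondegenerate_integral (hd : IsDualPair ℓ lam) :
    IsNondegenerateLeftIntegral k ℓ := by
  refine ⟨hd.1, isNondegenerateFunctional_of_right fun ψ hψ => ?_⟩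
  obtain ⟨x, hx⟩ := exists_eq_mul_left_of_nondegenerate hd.nondegenerate_functional.1
    (WDual.toDual ψ)
  have hψx : WDual.toDual ψ = WDual.toDual lam ∘ₗ LinearMap.mulLeft k x := LinearMap.ext hx
  have h0 : leftArrow (WDual.toDual ψ) ℓ = 0 := by
    refine eq_of_forall_dual (k := k) fun φ => ?_
    have := hψ (WDual.toDual.symm φ)
    rw [WDual.evalAt_apply, WDual.mul_eval _ _ ℓ (Repr.arbitrary k ℓ)] at this
    rw [leftArrow_eq_sum _ ℓ (Repr.arbitrary k ℓ), map_zero, ← this]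
    simp [mul_comm]
  rw [hψx, hd.leftArrow_mulLeft] at h0
  have hx0 : x = 0 := antipode_injective (k := k) (by rw [h0, map_zero])
  ext y
  rw [hx y, hx0, zero_mul, map_zero, map_zero]; rfl

/-- Every left integral is a right multiple of `ℓ` by an element of `H_t`. -/
theorem IsDualPair.eq_mul_leftArrow (hd : IsDualPair ℓ lam) {ℓ' : H} (hℓ' : IsLeftIntegral k ℓ') :
    ℓ' = ℓ * leftArrow (WDual.toDual lam) ℓ' := by
  rw [← sub_eq_zero]
  refine hd.nondegenerate_functional.2 _ fun g => ?_
  have hz := leftArrow_mem_targetBase hd.2.1 ℓ'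
  rw [mul_sub, map_sub, sub_eq_zero, ← mul_assoc, hℓ' g, hd.1 g,
    ← counit_leftArrow, ← counit_leftArrow (WDual.toDual lam), leftArrow_mul_target _ hz,
    leftArrow_target_mul _ (counitalTarget_mem g), leftArrow_target_mul _ (counitalTarget_mem g),
    hd.2.2, mul_one]

/-- The integral `ℓ` is a separating vector for right multiplication by `H_s`: if `ℓy = 0` then
`ℓ₁ ⊗ ℓ₂y = 0`, and the right legs of `Δ(ℓ)` span `H` by non-degeneracy. -/
theorem IsDualPair.eq_zero_of_mul_source (hd : IsDualPair ℓ lam) {y : H}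
    (hy : y ∈ sourceBase k H) (h0 : ℓ * y = 0) : y = 0 := by
  rw [← Module.forall_dual_apply_eq_zero_iff k]
  intro ψ
  have h1 : WDual.toDual.symm (ψ ∘ₗ LinearMap.mulRight k y) = (0 : WDual k H) := by
    refine hd.nondegenerate_integral.2.2 _ fun φ => ?_
    have h2 := comul_mul_source (k := k) hy ℓ
    rw [h0, map_zero, ← (Repr.arbitrary k ℓ).eq] at h2
    have h3 := congrArg (LinearMap.mul' k k ∘ₗ TensorProduct.map (WDual.toDual φ) ψ) h2.symm
    rw [WDual.evalAt_apply, WDual.mul_eval _ _ ℓ (Repr.arbitrary k ℓ)]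
    simpa [Finset.sum_mul] using h3
  have := congrArg (fun χ : WDual k H => χ 1) h1
  change ψ (1 * y) = 0 at this
  rwa [one_mul] at this

end Integrals

/-! ### The group-like functional of a dual pair -/

section GroupLike

variable {k H : Type*} [Field k] [Ring H] [WeakHopfAlgebra k H]

theorem tmul_mul_sum {ι : Type*} (a b : H) (t : Finset ι) (u f : ι → H) :
    (a ⊗ₜ[k] b) * ∑ i ∈ t, u i ⊗ₜ[k] f i = ∑ i ∈ t, (a * u i) ⊗ₜ[k] (b * f i) := by
  simp [Finset.mul_sum]

/-- For `g` with `Δ(g) = (g ⊗ g)Δ(1)`, `g S(g) = ε_t(g)`. -/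
theorem mul_antipode_of_comul_eq {g : H}
    (hg : comul (R := k) g = (g ⊗ₜ[k] g) * comul (1 : H)) :
    g * antipode k g = counitalTarget k g := by
  let r := Repr.arbitrary k (1 : H)
  have h1 := counitalTarget_eq_sum (k := k) (1 : H) r
  rw [counitalTarget_one] at h1
  rw [← mul_antipode, hg, ← r.eq, tmul_mul_sum]
  simp only [map_sum, LinearMap.lTensor_tmul, LinearMap.mul'_apply, antipode_mul_rev]
  have h2 : ∑ i ∈ r.index, g * r.left i * (antipode k (r.right i) * antipode k g) =
      g * (∑ i ∈ r.index, r.left i * antipode k (r.right i)) * antipode k g := by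
    simp only [Finset.mul_sum, Finset.sum_mul, mul_assoc]
  rw [h2, ← h1, mul_one]

/-- An element `g` with inverse `S(g)` and `Δ(g) = (g ⊗ g)Δ(1)` is group-like: applying `S` gives
`Δ(g⁻¹) = Δ(1)(g⁻¹ ⊗ g⁻¹)`, so that `g ⊗ g` commutes with `Δ(1)`. -/
theorem isGroupLike_of_comul_eq [FiniteDimensional k H] {g : H}
    (hg : comul (R := k) g = (g ⊗ₜ[k] g) * comul (1 : H)) (h1 : g * antipode k g = 1)
    (h2 : antipode k g * g = 1) : IsGroupLike k g := by
  refine ⟨⟨⟨g, antipode k g, h1, h2⟩, rfl⟩, hg, hg.trans ?_⟩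
  have h3 : comul (R := k) (antipode k g) =
      comul (1 : H) * (antipode k g ⊗ₜ[k] antipode k g) := by
    have h4 := comul_antipode (k := k) (1 : H)
    rw [antipode_one] at h4
    have key (x : H ⊗[k] H) : TensorProduct.comm k H H
        (TensorProduct.map (antipode k) (antipode k) ((g ⊗ₜ[k] g) * x)) =
        TensorProduct.comm k H H (TensorProduct.map (antipode k) (antipode k) x) *
          (antipode k g ⊗ₜ[k] antipode k g) := by
      induction x with
      | zero => simp
      | add a b ha hb => simp only [mul_add, map_add, ha, hb, add_mul]
      | tmul a b => simp [antipode_mul_rev]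
    rw [comul_antipode, hg, key, ← h4]
  have h5 : comul (R := k) (1 : H) =
      (g ⊗ₜ[k] g) * comul (1 : H) * (antipode k g ⊗ₜ[k] antipode k g) := by
    conv_lhs => rw [← h1, comul_mul, hg, h3, ← mul_assoc, mul_assoc (g ⊗ₜ[k] g), comul_mul_one]
  conv_rhs => rw [h5, mul_assoc, Algebra.TensorProduct.tmul_mul_tmul, h2,
    ← Algebra.TensorProduct.one_def, mul_one]

/-- `1₁ ⊗ z 1₂ = S(z) 1₁ ⊗ 1₂` for `z ∈ H_t`. -/
theorem sum_base_target_mul {z : H} (hz : z ∈ targetBase k H) :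
    ∑ i ∈ (baseRepr k H).index, (baseRepr k H).left i ⊗ₜ[k] (z * (baseRepr k H).right i) =
      ∑ i ∈ (baseRepr k H).index,
        (antipode k z * (baseRepr k H).left i) ⊗ₜ[k] (baseRepr k H).right i := by
  have h1 := rTensor_counitalSource_comul (k := k) z
  have h2 := comul_target_mul hz 1
  rw [mul_one] at h2
  rw [h2, ← (baseRepr k H).eq, tmul_mul_sum, tmul_mul_sum] at h1
  simp only [map_sum, LinearMap.rTensor_tmul, one_mul,
    counitalSource_mul_source (baseRepr_left_mem _)] at h1
  rw [← h1, antipode_target hz]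

/-- `1₁ y ⊗ 1₂ = 1₁ ⊗ 1₂ S(y)` for `y ∈ H_s`. -/
theorem sum_base_mul_source {y : H} (hy : y ∈ sourceBase k H) :
    ∑ i ∈ (baseRepr k H).index, ((baseRepr k H).left i * y) ⊗ₜ[k] (baseRepr k H).right i =
      ∑ i ∈ (baseRepr k H).index,
        (baseRepr k H).left i ⊗ₜ[k] ((baseRepr k H).right i * antipode k y) := by
  have h1 := lTensor_counitalTarget_comul (k := k) y
  have h2 := comul_mul_source hy 1
  rw [one_mul] at h2
  rw [h2, ← (baseRepr k H).eq, Finset.sum_mul, Finset.sum_mul] at h1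
  simp only [map_sum, LinearMap.lTensor_tmul, Algebra.TensorProduct.tmul_mul_tmul, mul_one,
    counitalTarget_target_mul (baseRepr_right_mem _)] at h1
  rw [← h1, antipode_source hy]

theorem counit_source_mul_target_eq {y z : H} (hy : y ∈ sourceBase k H)
    (hz : z ∈ targetBase k H) : counit (R := k) (y * z) = counit (R := k) (z * antipode k y) := by
  rw [antipode_source hy, counit_mul_counitalTarget, commute_target_source hz hy]

/-- If `S² = id` on `H_t`, then `ε` is a trace on `H_t`. -/
theorem counit_mul_comm_target (ht : ∀ z ∈ targetBase k H, antipode k (antipode k z) = z)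
    {z w : H} (hz : z ∈ targetBase k H) (hw : w ∈ targetBase k H) :
    counit (R := k) (z * w) = counit (R := k) (w * z) := by
  rw [← counit_counitalSource_mul, ← antipode_target hz,
    counit_source_mul_target_eq (antipode_target_mem hz) hw, ht z hz]

/-- If `S² = id` on `H_s`, then `y 1₁ ⊗ 1₂ = 1₁ ⊗ S(y) 1₂` for `y ∈ H_s`; that is, `1₁ ⊗ S(1₂)` is a
Casimir element of `H_s`. -/
theorem sum_base_left_mul (hs : ∀ y ∈ sourceBase k H, antipode k (antipode k y) = y)
    {y : H} (hy : y ∈ sourceBase k H) :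
    ∑ i ∈ (baseRepr k H).index, (y * (baseRepr k H).left i) ⊗ₜ[k] (baseRepr k H).right i =
      ∑ i ∈ (baseRepr k H).index,
        (baseRepr k H).left i ⊗ₜ[k] (antipode k y * (baseRepr k H).right i) := by
  rw [sum_base_target_mul (antipode_source_mem hy), hs y hy]

/-- If `S² = id` on the bases, then `S(1₁) ⊗ 1₂` is a Casimir element of `H_t`. -/
theorem sum_base_casimir (ht : ∀ z ∈ targetBase k H, antipode k (antipode k z) = z)
    {z : H} (hz : z ∈ targetBase k H) :
    ∑ i ∈ (baseRepr k H).index,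
        (z * antipode k ((baseRepr k H).left i)) ⊗ₜ[k] (baseRepr k H).right i =
      ∑ i ∈ (baseRepr k H).index,
        antipode k ((baseRepr k H).left i) ⊗ₜ[k] ((baseRepr k H).right i * z) := by
  have := congrArg ((antipode k).rTensor H) (sum_base_mul_source (antipode_target_mem hz))
  simpa [antipode_mul_rev, ht z hz] using this

theorem sum_antipode_base_mul :
    ∑ i ∈ (baseRepr k H).index,
      antipode k ((baseRepr k H).left i) * (baseRepr k H).right i = 1 := by
  rw [← counitalSource_eq_sum 1 (baseRepr k H), counitalSource_one]

theorem sum_base_mul_antipode :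
    ∑ i ∈ (baseRepr k H).index,
      (baseRepr k H).left i * antipode k ((baseRepr k H).right i) = 1 := by
  rw [← counitalTarget_eq_sum 1 (baseRepr k H), counitalTarget_one]

theorem sum_antipode_base_right_mul
    (hs : ∀ y ∈ sourceBase k H, antipode k (antipode k y) = y) :
    ∑ i ∈ (baseRepr k H).index,
      antipode k ((baseRepr k H).right i) * (baseRepr k H).left i = 1 := by
  have := congrArg (antipode k) (sum_antipode_base_mul (k := k) (H := H))
  simpa [antipode_mul_rev, antipode_one, hs _ (baseRepr_left_mem _)] using this

theorem sum_base_right_mul_antipode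
    (ht : ∀ z ∈ targetBase k H, antipode k (antipode k z) = z) :
    ∑ i ∈ (baseRepr k H).index,
      (baseRepr k H).right i * antipode k ((baseRepr k H).left i) = 1 := by
  have := congrArg (antipode k) (sum_base_mul_antipode (k := k) (H := H))
  simpa [antipode_mul_rev, antipode_one, ht _ (baseRepr_right_mem _)] using this

/-- `g₁ ε(x g₂) = ε_s(x) g`. -/
theorem sum_counit_mul_smul (x g : H) {ι : Type*} (r : Repr k g ι) :
    ∑ j ∈ r.index, counit (R := k) (x * r.right j) • r.left j = counitalSource k x * g := by
  have h2 : (TensorProduct.rid k H) (counit.lTensor H (comul (R := k) (counitalSource k x * g))) =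
      counitalSource k x * g := by simp
  rw [comul_source_mul (counitalSource_mem x), ← r.eq, tmul_mul_sum] at h2
  simp only [map_sum, LinearMap.lTensor_tmul, TensorProduct.rid_tmul, one_mul,
    counit_counitalSource_mul] at h2
  exact h2

/-- The map `h ↦ λ ⇀ (ℓh)` for functionals `λ`. For a dual pair of left integrals it is valued in
`H_t` and describes right multiplication on left integrals: `ℓh = ℓ(λ ⇀ ℓh)`. -/
noncomputable def modularMap [FiniteDimensional k H] (ℓ : H) (lam : WDual k H) : H →ₗ[k] H :=
  (TensorProduct.rid k H).toLinearMap ∘ₗ (WDual.toDual lam).lTensor H ∘ₗ comul ∘ₗ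
    LinearMap.mulLeft k ℓ

variable [FiniteDimensional k H] {ℓ : H} {lam : WDual k H}

theorem modularMap_apply (h : H) :
    modularMap ℓ lam h = leftArrow (WDual.toDual lam) (ℓ * h) := rfl

theorem counit_modularMap (h : H) : counit (R := k) (modularMap ℓ lam h) = lam (ℓ * h) :=
  counit_leftArrow _ _

namespace IsDualPair

theorem modularMap_mem (hd : IsDualPair ℓ lam) (h : H) : modularMap ℓ lam h ∈ targetBase k H :=
  leftArrow_mem_targetBase hd.2.1 _

theorem mul_modularMap (hd : IsDualPair ℓ lam) (h : H) : ℓ * modularMap ℓ lam h = ℓ * h :=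
  (hd.eq_mul_leftArrow (hd.1.mul_right h)).symm

theorem modularMap_one (hd : IsDualPair ℓ lam) : modularMap ℓ lam 1 = 1 := by
  rw [modularMap_apply, mul_one, hd.2.2]

theorem modularMap_mul_source (hd : IsDualPair ℓ lam) (h : H) {y : H} (hy : y ∈ sourceBase k H) :
    modularMap ℓ lam (h * y) = modularMap ℓ lam y * modularMap ℓ lam h := by
  rw [modularMap_apply, ← mul_assoc, ← hd.mul_modularMap, mul_assoc,
    commute_target_source (hd.modularMap_mem h) hy, ← mul_assoc,
    leftArrow_mul_target _ (hd.modularMap_mem h), ← modularMap_apply]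

theorem modularMap_injOn (hd : IsDualPair ℓ lam) {y x : H} (hy : y ∈ sourceBase k H)
    (hx : x ∈ sourceBase k H) (h : modularMap ℓ lam y = modularMap ℓ lam x) : y = x := by
  rw [← sub_eq_zero]
  refine hd.eq_zero_of_mul_source (Submodule.sub_mem _ hy hx) ?_
  rw [mul_sub, ← hd.mul_modularMap y, h, hd.mul_modularMap, sub_self]

/-- `κ : H_s → H_t` is surjective, as `κ ∘ S` is an injective endomorphism of `H_t`. -/
theorem exists_modularMap_eq (hd : IsDualPair ℓ lam) {z : H} (hz : z ∈ targetBase k H) :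
    ∃ y ∈ sourceBase k H, modularMap ℓ lam y = z := by
  let K : targetBase k H →ₗ[k] targetBase k H :=
    (modularMap ℓ lam ∘ₗ antipode k).restrict fun x _ => hd.modularMap_mem _
  have hK : Function.Injective K := fun x y hxy => Subtype.ext <| antipode_injective (k := k) <|
    hd.modularMap_injOn (antipode_target_mem x.2) (antipode_target_mem y.2)
      (congrArg Subtype.val hxy)
  obtain ⟨x, hx⟩ := LinearMap.injective_iff_surjective.1 hK ⟨z, hz⟩
  exact ⟨antipode k x, antipode_target_mem x.2, congrArg Subtype.val hx⟩

/-- The anti-isomorphism `κ : H_s → H_t` with `ℓy = ℓκ(y)` carries the Casimir element of `H_s` to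
that of `H_t`: `κ(1₁) ⊗ κ(S(1₂)) = S(1₁) ⊗ 1₂`. Both sides equal
`κ(1₁)S(1₁') ⊗ 1₂'κ(S(1₂))`, by the Casimir property of the one and of the other. -/
theorem sum_modularMap_base (hd : IsDualPair ℓ lam)
    (ht : ∀ z ∈ targetBase k H, antipode k (antipode k z) = z)
    (hs : ∀ y ∈ sourceBase k H, antipode k (antipode k y) = y) :
    ∑ i ∈ (baseRepr k H).index, modularMap ℓ lam ((baseRepr k H).left i) ⊗ₜ[k]
        modularMap ℓ lam (antipode k ((baseRepr k H).right i)) =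
      ∑ i ∈ (baseRepr k H).index,
        antipode k ((baseRepr k H).left i) ⊗ₜ[k] (baseRepr k H).right i := by
  set κ := modularMap ℓ lam with hκ
  set u := (baseRepr k H).left with hu
  set f := (baseRepr k H).right with hf
  set t := (baseRepr k H).index with htt
  have hum (i) : u i ∈ sourceBase k H := baseRepr_left_mem i
  have hfm (i) : f i ∈ targetBase k H := baseRepr_right_mem i
  have h1 (i) : ∑ j ∈ t, (κ (u i) * antipode k (u j)) ⊗ₜ[k] (f j * κ (antipode k (f i))) =
      ∑ j ∈ t, antipode k (u j) ⊗ₜ[k] (f j * κ (antipode k (f i) * u i)) := by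
    have := congrArg (· * ((1 : H) ⊗ₜ[k] κ (antipode k (f i))))
      (sum_base_casimir ht (hd.modularMap_mem (u i)))
    simp only [Finset.sum_mul, Algebra.TensorProduct.tmul_mul_tmul, mul_one] at this
    rw [hd.modularMap_mul_source _ (hum i)]
    simpa only [mul_assoc] using this
  have h2 (j) : ∑ i ∈ t, (κ (u i) * antipode k (u j)) ⊗ₜ[k] (f j * κ (antipode k (f i))) =
      ∑ i ∈ t, κ (u i) ⊗ₜ[k] (f j * antipode k (u j) * κ (antipode k (f i))) := by
    obtain ⟨v, hv, hvj⟩ := hd.exists_modularMap_eq (antipode_source_mem (hum j))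
    have := congrArg (TensorProduct.map κ (LinearMap.mulLeft k (f j) ∘ₗ κ ∘ₗ antipode k))
      (sum_base_left_mul hs hv)
    simp only [map_sum, TensorProduct.map_tmul, LinearMap.comp_apply, LinearMap.mulLeft_apply,
      antipode_mul_rev, hs v hv] at this
    simp only [← hvj, mul_assoc, ← hκ]
    calc _ = ∑ i ∈ t, κ (v * u i) ⊗ₜ[k] (f j * κ (antipode k (f i))) := by
          refine Finset.sum_congr rfl fun i _ => ?_
          rw [hd.modularMap_mul_source _ (hum i)]
      _ = _ := by
          refine this.trans (Finset.sum_congr rfl fun i _ => ?_)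
          rw [hd.modularMap_mul_source _ hv]
  calc ∑ i ∈ t, κ (u i) ⊗ₜ[k] κ (antipode k (f i))
      = ∑ i ∈ t, κ (u i) ⊗ₜ[k] ((∑ j ∈ t, f j * antipode k (u j)) * κ (antipode k (f i))) := by
        rw [sum_base_right_mul_antipode ht]; simp
    _ = ∑ i ∈ t, ∑ j ∈ t, (κ (u i) * antipode k (u j)) ⊗ₜ[k] (f j * κ (antipode k (f i))) := by
        rw [Finset.sum_comm]
        simp only [h2]
        rw [Finset.sum_comm]
        simp only [Finset.sum_mul, tmul_sum]
    _ = ∑ j ∈ t, antipode k (u j) ⊗ₜ[k] (f j * κ (∑ i ∈ t, antipode k (f i) * u i)) := by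
        simp only [h1]
        rw [Finset.sum_comm]
        simp only [map_sum, Finset.mul_sum, tmul_sum]
    _ = ∑ j ∈ t, antipode k (u j) ⊗ₜ[k] f j := by
        rw [sum_antipode_base_right_mul hs, hd.modularMap_one]; simp

/-- `ε(κ(y)) = ε(y)` for `y ∈ H_s`. -/
theorem counit_modularMap_source (hd : IsDualPair ℓ lam)
    (ht : ∀ z ∈ targetBase k H, antipode k (antipode k z) = z)
    (hs : ∀ y ∈ sourceBase k H, antipode k (antipode k y) = y) {y : H}
    (hy : y ∈ sourceBase k H) :
    counit (R := k) (modularMap ℓ lam y) = counit (R := k) y := by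
  set κ := modularMap ℓ lam with hκ
  set B := baseRepr k H with hB
  have hum (i) : B.left i ∈ sourceBase k H := baseRepr_left_mem i
  -- `1₁ ε(κ(S(1₂))) = 1`, as its image under `κ` is `S(1₁) ε(1₂) = 1`
  have h1 : ∑ i ∈ B.index, counit (R := k) (κ (antipode k (B.right i))) • B.left i = 1 := by
    refine hd.modularMap_injOn (Submodule.sum_mem _ fun i _ => Submodule.smul_mem _ _ (hum i))
      one_mem_sourceBase ?_
    have := congrArg ((TensorProduct.rid k H).toLinearMap ∘ₗ counit.lTensor H)
      (hd.sum_modularMap_base ht hs)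
    simp only [LinearMap.comp_apply, map_sum, LinearMap.lTensor_tmul, LinearEquiv.coe_coe,
      TensorProduct.rid_tmul, ← map_smul] at this
    rw [← map_sum (antipode k), sum_counit_smul_right, antipode_one] at this
    rw [hd.modularMap_one, map_sum]
    exact this
  have h2 := congrArg (LinearMap.mul' k k ∘ₗ TensorProduct.map counit
    (counit (R := k) ∘ₗ κ ∘ₗ antipode k)) (sum_base_left_mul hs hy)
  simp only [LinearMap.comp_apply, map_sum, TensorProduct.map_tmul, LinearMap.mul'_apply,
    antipode_mul_rev, hs y hy] at h2
  calc counit (R := k) (κ y)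
      = counit (κ (antipode k (∑ i ∈ B.index, counit (R := k) (B.left i) • B.right i) * y)) := by
        rw [Coalgebra.sum_counit_smul, antipode_one, one_mul]
    _ = ∑ i ∈ B.index, counit (R := k) (B.left i) *
          counit (κ (antipode k (B.right i) * y)) := by
        simp [Finset.sum_mul]
    _ = counit (y * ∑ i ∈ B.index, counit (R := k) (κ (antipode k (B.right i))) • B.left i) := by
        rw [← h2]
        simp [Finset.mul_sum, mul_comm]
        rfl
    _ = counit (R := k) y := by rw [h1, mul_one]

theorem rightArrow_evalAt (φ : WDual k H) (ℓ h : H) :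
    (rightArrow φ (WDual.evalAt (k := k) ℓ) : WDual k H) h = φ (ℓ * h) := by
  rw [← WDual.ev₂_comul, rightArrow_eq_sum _ φ (Repr.arbitrary k φ),
    ← (Repr.arbitrary k φ).eq]
  simp only [map_sum, WDual.ev₂_tmul, LinearMap.sum_apply]
  rfl

/-- The functional `α = λ ↼ ℓ` satisfies `Δ(α) = (α ⊗ α)Δ(1)`. Evaluated at `h ⊗ g`, the right-hand
side is `α(h₁) α(ε_s(h₂) g) = α(h 1₁) α(S(1₂) g)`, and writing this in terms of `κ` and carrying the
Casimir element of `H_s` over to that of `H_t` gives `α(hg)`. -/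
theorem comul_rightArrow (hd : IsDualPair ℓ lam)
    (ht : ∀ z ∈ targetBase k H, antipode k (antipode k z) = z)
    (hs : ∀ y ∈ sourceBase k H, antipode k (antipode k y) = y) :
    comul (R := k) (rightArrow lam (WDual.evalAt (k := k) ℓ)) =
      (rightArrow lam (WDual.evalAt (k := k) ℓ) ⊗ₜ[k] rightArrow lam (WDual.evalAt (k := k) ℓ)) *
        comul (1 : WDual k H) := by
  set α : WDual k H := rightArrow lam (WDual.evalAt (k := k) ℓ) with hα
  set κ := modularMap ℓ lam with hκ
  have hαe (h : H) : α h = lam (ℓ * h) := rightArrow_evalAt _ _ _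
  refine WDual.ext₂ fun h g => ?_
  let r := Repr.arbitrary k h
  let s := Repr.arbitrary k g
  let B := baseRepr k H
  have h1 := congrArg (LinearMap.mul' k k ∘ₗ TensorProduct.map (WDual.toDual α)
    (WDual.toDual α ∘ₗ LinearMap.mulRight k g)) (lTensor_counitalSource_comul (k := k) h)
  rw [← r.eq, ← B.eq] at h1
  simp only [LinearMap.comp_apply, map_sum, TensorProduct.map_tmul, LinearMap.mul'_apply,
    LinearMap.lTensor_tmul, LinearMap.mulRight_apply, Finset.mul_sum,
    Algebra.TensorProduct.tmul_mul_tmul, one_mul] at h1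
  have h2 := congrArg (LinearMap.mul' k k ∘ₗ TensorProduct.map
    (counit (R := k) ∘ₗ LinearMap.mulRight k (κ h))
    (WDual.toDual lam ∘ₗ LinearMap.mulLeft k ℓ ∘ₗ LinearMap.mulRight k g))
    (hd.sum_modularMap_base ht hs)
  simp only [LinearMap.comp_apply, map_sum, TensorProduct.map_tmul, LinearMap.mul'_apply,
    LinearMap.mulRight_apply, LinearMap.mulLeft_apply] at h2
  rw [WDual.ev₂_mul h g _ _ r s, WDual.ev₂_comul]
  symm
  calc _ = ∑ i ∈ r.index, α (r.left i) * α (counitalSource k (r.right i) * g) := by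
        refine Finset.sum_congr rfl fun i _ => ?_
        rw [← sum_counit_mul_smul _ g s, map_sum, Finset.mul_sum]
        refine Finset.sum_congr rfl fun j _ => ?_
        rw [WDual.ev₂_tmul, WDual.ev₂_comul, WDual.one_eval, map_smul, smul_eq_mul]
        ring
    _ = ∑ i ∈ B.index, α (h * B.left i) * α (antipode k (B.right i) * g) := h1
    _ = ∑ i ∈ B.index, counit (R := k) (κ (B.left i) * κ h) *
          lam (ℓ * (κ (antipode k (B.right i)) * g)) := by
        refine Finset.sum_congr rfl fun i _ => ?_
        rw [hαe, hαe, ← counit_modularMap, hd.modularMap_mul_source _ (baseRepr_left_mem i),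
          ← mul_assoc ℓ (antipode k _), ← hd.mul_modularMap (antipode k _), mul_assoc]
    _ = ∑ i ∈ B.index, counit (R := k) (antipode k (B.left i) * κ h) *
          lam (ℓ * (B.right i * g)) := h2
    _ = lam (ℓ * ((∑ i ∈ B.index, counit (R := k) (B.left i * κ h) • B.right i) * g)) := by
        simp only [Finset.sum_mul, Finset.mul_sum, map_sum, smul_mul_assoc, mul_smul_comm,
          map_smul, smul_eq_mul]
        refine Finset.sum_congr rfl fun i _ => ?_
        rw [counit_mul_comm_target ht (antipode_source_mem (baseRepr_left_mem i))
          (hd.modularMap_mem h), ← counit_source_mul_target_eq (baseRepr_left_mem i)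
          (hd.modularMap_mem h)]
    _ = α (h * g) := by
        rw [← counitalTarget_apply, counitalTarget_of_mem (hd.modularMap_mem h), hαe, ← mul_assoc,
          hd.mul_modularMap, mul_assoc]

theorem rightArrow_mul_antipode (hd : IsDualPair ℓ lam)
    (ht : ∀ z ∈ targetBase k H, antipode k (antipode k z) = z)
    (hs : ∀ y ∈ sourceBase k H, antipode k (antipode k y) = y) :
    rightArrow lam (WDual.evalAt (k := k) ℓ) *
      antipode k (rightArrow lam (WDual.evalAt (k := k) ℓ)) = 1 := by
  rw [mul_antipode_of_comul_eq (hd.comul_rightArrow ht hs)]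
  ext h
  rw [WDual.counitalTarget_eval, rightArrow_evalAt,
    hd.apply_mul_target (counitalTarget_mem h), WDual.one_eval, ← one_mul (counitalTarget k h),
    counit_mul_counitalTarget, one_mul]

/-- A right inverse in a finite-dimensional algebra is a left inverse. -/
theorem antipode_mul_rightArrow (hd : IsDualPair ℓ lam)
    (ht : ∀ z ∈ targetBase k H, antipode k (antipode k z) = z)
    (hs : ∀ y ∈ sourceBase k H, antipode k (antipode k y) = y) :
    antipode k (rightArrow lam (WDual.evalAt (k := k) ℓ)) *
      rightArrow lam (WDual.evalAt (k := k) ℓ) = 1 := by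
  have : IsNoetherianRing (WDual k H) :=
    isNoetherian_of_tower k (inferInstance : IsNoetherian k (WDual k H))
  exact mul_eq_one_symm (hd.rightArrow_mul_antipode ht hs)

/-- The functional `α = λ ↼ ℓ` is the modular functional of `ℓ` itself: if `ℓh = ℓy` with `y ∈ H_s`,
then `α(h) = ε(κ(y)) = ε(y)`. -/
theorem isDistinguished_rightArrow (hd : IsDualPair ℓ lam)
    (ht : ∀ z ∈ targetBase k H, antipode k (antipode k z) = z)
    (hs : ∀ y ∈ sourceBase k H, antipode k (antipode k y) = y) :
    IsDistinguished (rightArrow lam (WDual.evalAt (k := k) ℓ)) := by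
  refine ⟨isGroupLike_of_comul_eq (hd.comul_rightArrow ht hs) (hd.rightArrow_mul_antipode ht hs)
    (hd.antipode_mul_rightArrow ht hs), ℓ, _, 1, hd.nondegenerate_integral, fun h => ?_,
    ⟨1, one_mem_sourceBase, by simp [antipode_one]⟩, (mul_one _).symm⟩
  obtain ⟨y, hy, hyh⟩ := hd.exists_modularMap_eq (hd.modularMap_mem h)
  refine ⟨y, hy, ?_, ?_⟩
  · rw [← hd.mul_modularMap h, ← hyh, hd.mul_modularMap]
  · rw [rightArrow_evalAt, ← counit_modularMap, ← hyh, hd.counit_modularMap_source ht hs hy]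

end IsDualPair

end GroupLike

/-! ### The double dual -/

section BiDual

variable {k H : Type*} [Field k] [Ring H] [WeakHopfAlgebra k H] [FiniteDimensional k H]

/-- The element of `H**` given by evaluation at an element of `H`. -/
noncomputable def biDual (h : H) : WDual k (WDual k H) := WDual.toDual.symm (WDual.evalAt h)

theorem biDual_apply (h : H) (φ : WDual k H) : biDual h φ = φ h := rfl

theorem biDual_injective : Function.Injective (biDual (k := k) (H := H)) := fun _ _ hxy =>
  eq_of_forall_dual (k := k) fun φ =>
    congrArg (fun Φ : WDual k (WDual k H) => Φ (WDual.toDual.symm φ)) hxy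

theorem biDual_surjective : Function.Surjective (biDual (k := k) (H := H)) := fun Φ => by
  obtain ⟨h, hh⟩ := (Module.evalEquiv k H).surjective
    (WDual.toDual Φ ∘ₗ (WDual.toDual (k := k) (H := H)).symm.toLinearMap)
  refine ⟨h, WDual.ext fun φ => ?_⟩
  exact congrArg (fun f : Module.Dual k (Module.Dual k H) => f (WDual.toDual φ)) hh

theorem biDual_mul_apply (g : H) (Φ : WDual k (WDual k H)) (φ : WDual k H) :
    (Φ * biDual (k := k) g : WDual k (WDual k H)) φ = Φ (leftArrow (WDual.evalAt g) φ) := by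
  rw [WDual.mul_eval _ _ φ (Repr.arbitrary k φ), leftArrow_eq_sum _ φ (Repr.arbitrary k φ)]
  simp [biDual_apply, WDual.evalAt_apply, mul_comm]

theorem leftArrow_evalAt (φ : WDual k H) (ℓ h : H) :
    (leftArrow (WDual.evalAt (k := k) ℓ) φ : WDual k H) h = φ (h * ℓ) := by
  rw [← WDual.ev₂_comul, leftArrow_eq_sum _ φ (Repr.arbitrary k φ),
    ← (Repr.arbitrary k φ).eq]
  simp only [map_sum, WDual.ev₂_tmul, LinearMap.sum_apply]
  refine Finset.sum_congr rfl fun i _ => ?_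
  rw [map_smul]
  exact mul_comm _ _

theorem biDual_mul (g h : H) : biDual (k := k) (g * h) = biDual g * biDual h := by
  ext φ
  rw [biDual_mul_apply, biDual_apply, biDual_apply, leftArrow_evalAt]

theorem biDual_one : biDual (k := k) (1 : H) = 1 := rfl

theorem antipode_biDual (h : H) : antipode k (biDual (k := k) h) = biDual (antipode k h) := rfl

theorem counitalTarget_biDual (h : H) :
    counitalTarget k (biDual (k := k) h) = biDual (counitalTarget k h) := by
  ext φ
  rw [WDual.counitalTarget_eval, biDual_apply, biDual_apply, WDual.counitalTarget_eval]

variable {ℓ : H} {lam : WDual k H}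

/-- A dual pair of left integrals of `H` is a dual pair of left integrals of `H*`, with the roles
exchanged. -/
theorem IsDualPair.dual (hd : IsDualPair ℓ lam) : IsDualPair lam (biDual (k := k) ℓ) := by
  refine ⟨hd.2.1, fun Φ => ?_, ?_⟩
  · obtain ⟨h, rfl⟩ := biDual_surjective Φ
    rw [counitalTarget_biDual, ← biDual_mul, ← biDual_mul, hd.1 h]
  · ext h
    exact (leftArrow_evalAt lam ℓ h).trans (hd.apply_mul h)

theorem counitalTarget_antipode_antipode
    (hs : ∀ y ∈ sourceBase k H, antipode k (antipode k y) = y) (h : H) :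
    counitalTarget k (antipode k (antipode k h)) = counitalTarget k h := by
  rw [counitalTarget_apply _ (baseRepr k H), counitalTarget_apply _ (baseRepr k H)]
  refine Finset.sum_congr rfl fun i _ => ?_
  conv_lhs => rw [← hs _ (baseRepr_left_mem i), ← antipode_mul_rev, ← antipode_mul_rev,
    counit_antipode, counit_antipode]

theorem counitalSource_antipode_antipode
    (ht : ∀ z ∈ targetBase k H, antipode k (antipode k z) = z) (h : H) :
    counitalSource k (antipode k (antipode k h)) = counitalSource k h := by
  rw [counitalSource_apply _ (baseRepr k H), counitalSource_apply _ (baseRepr k H)]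
  refine Finset.sum_congr rfl fun i _ => ?_
  conv_lhs => rw [← ht _ (baseRepr_right_mem i), ← antipode_mul_rev, ← antipode_mul_rev,
    counit_antipode, counit_antipode]

theorem antipode_antipode_target_dual
    (hs : ∀ y ∈ sourceBase k H, antipode k (antipode k y) = y) :
    ∀ ζ ∈ targetBase k (WDual k H), antipode k (antipode k ζ) = ζ := by
  rintro _ ⟨φ, rfl⟩
  ext h
  change counitalTarget k φ (antipode k (antipode k h)) = _
  rw [WDual.counitalTarget_eval, WDual.counitalTarget_eval, counitalTarget_antipode_antipode hs]

theorem antipode_antipode_source_dual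
    (ht : ∀ z ∈ targetBase k H, antipode k (antipode k z) = z) :
    ∀ ζ ∈ sourceBase k (WDual k H), antipode k (antipode k ζ) = ζ := by
  rintro _ ⟨φ, rfl⟩
  ext h
  change counitalSource k φ (antipode k (antipode k h)) = _
  rw [WDual.counitalSource_eval, WDual.counitalSource_eval, counitalSource_antipode_antipode ht]

theorem apply_mul_eq_sum (φ : WDual k H) (x y : H) {ι : Type*} (t : Repr k φ ι) :
    φ (x * y) = ∑ i ∈ t.index, t.left i x * t.right i y := by
  rw [← WDual.ev₂_comul, ← t.eq, map_sum]
  rfl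

/-- The embedding in `H**` reflects the relation `Δ(a) = (a ⊗ a)Δ(1)`. -/
theorem comul_eq_of_biDual {a : H} (ha : comul (R := k) (biDual (k := k) a) =
      (biDual (k := k) a ⊗ₜ[k] biDual (k := k) a) * comul (1 : WDual k (WDual k H))) :
    comul (R := k) a = (a ⊗ₜ[k] a) * comul (1 : H) := by
  refine tensor_ext_of_dual fun φ ψ => ?_
  let φ' : WDual k H := WDual.toDual.symm φ
  let ψ' : WDual k H := WDual.toDual.symm ψ
  let r := Repr.arbitrary k φ'
  let s := Repr.arbitrary k ψ'
  let B := Repr.arbitrary k (1 : H)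
  have h1 := congrArg (WDual.ev₂ φ' ψ') ha
  rw [WDual.ev₂_comul, WDual.ev₂_mul φ' ψ' _ _ r s] at h1
  refine Eq.trans h1 ?_
  rw [← B.eq, tmul_mul_sum]
  simp only [map_sum, TensorProduct.map_tmul, LinearMap.mul'_apply]
  calc _ = ∑ i ∈ r.index, ∑ j ∈ s.index, ∑ m ∈ B.index,
        (r.left i a * r.right i (B.left m)) * (s.left j a * s.right j (B.right m)) := by
        refine Finset.sum_congr rfl fun i _ => Finset.sum_congr rfl fun j _ => ?_
        rw [WDual.ev₂_comul, WDual.ev₂_tmul, WDual.one_eval, WDual.counit_eval,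
          WDual.mul_eval _ _ _ B, Finset.mul_sum]
        refine Finset.sum_congr rfl fun m _ => ?_
        rw [biDual_apply, biDual_apply]
        ring
    _ = ∑ m ∈ B.index, φ' (a * B.left m) * ψ' (a * B.right m) := by
        simp only [apply_mul_eq_sum φ' _ _ r, apply_mul_eq_sum ψ' _ _ s, Finset.sum_mul_sum]
        rw [Finset.sum_comm (s := B.index)]
        exact Finset.sum_congr rfl fun i _ => Finset.sum_comm
    _ = _ := rfl

end BiDual

/-! ### The Nakayama automorphism -/

section Radford

variable {k H : Type*} [Field k] [Ring H] [WeakHopfAlgebra k H]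

/-- `h₁ ⊗ h₂ S(h₃) = h₁ ⊗ ε_t(h₂)`. -/
theorem sum_comul_mul_antipode (h : H) {ι : Type*} (r : Repr k h ι) :
    ∑ i ∈ r.index, comul (R := k) (r.left i) * ((1 : H) ⊗ₜ[k] antipode k (r.right i)) =
      (counitalTarget k).lTensor H (comul h) := by
  let F : (H ⊗[k] H) ⊗[k] H →ₗ[k] H ⊗[k] H :=
    (LinearMap.mul' k H ∘ₗ (antipode k).lTensor H).lTensor H ∘ₗ
      (TensorProduct.assoc k H H H).toLinearMap
  have hF (x : H ⊗[k] H) (a : H) : F (x ⊗ₜ a) = x * ((1 : H) ⊗ₜ[k] antipode k a) := by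
    induction x with
    | zero => simp
    | add a b ha hb => simp only [add_tmul, map_add, ha, hb, add_mul]
    | tmul a b => simp [F]
  have h1 : F (comul.rTensor H (comul h)) =
      (LinearMap.mul' k H ∘ₗ (antipode k).lTensor H).lTensor H (comul.lTensor H (comul h)) := by
    simp [F]
  rw [← LinearMap.lTensor_comp_apply] at h1
  have h2 : (LinearMap.mul' k H ∘ₗ (antipode k).lTensor H) ∘ₗ comul =
      counitalTarget k (H := H) := LinearMap.ext mul_antipode
  rw [← h2, ← h1, ← r.eq]
  simp [hF]

/-- `h₁ S(z) ⊗ h₂ = h₁ ⊗ h₂ z` for `z ∈ H_t`, if `S² = id` on `H_t`. -/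
theorem comul_mul_antipode_target (ht : ∀ z ∈ targetBase k H, antipode k (antipode k z) = z)
    {z : H} (hz : z ∈ targetBase k H) (h : H) :
    comul (R := k) h * (antipode k z ⊗ₜ[k] (1 : H)) = comul h * ((1 : H) ⊗ₜ[k] z) := by
  have := sum_base_mul_source (antipode_target_mem hz)
  rw [ht z hz] at this
  rw [← comul_mul_one, mul_assoc, mul_assoc, ← (baseRepr k H).eq]
  congr 1
  simpa [Finset.sum_mul] using this

theorem leftArrow_leftArrow (φ ψ : WDual k H) (h : H) :
    leftArrow (WDual.toDual φ) (leftArrow (WDual.toDual ψ) h) =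
      leftArrow (WDual.toDual (φ * ψ)) h := by
  have key (χ θ : WDual k H) (x : H) : χ (leftArrow (WDual.toDual θ) x) = (χ * θ) x := by
    rw [leftArrow_eq_sum _ x (Repr.arbitrary k x), WDual.mul_eval _ _ x (Repr.arbitrary k x)]
    simp [mul_comm]
  refine eq_of_forall_dual (k := k) fun χ => ?_
  change WDual.toDual.symm χ _ = WDual.toDual.symm χ _
  rw [key, key, key, mul_assoc]

theorem leftArrow_one (h : H) : leftArrow (WDual.toDual (1 : WDual k H)) h = h := by
  rw [leftArrow_eq_sum _ h (Repr.arbitrary k h)]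
  exact sum_counit_smul_right h _

theorem counit_rightArrow (f : Module.Dual k H) (h : H) :
    counit (R := k) (rightArrow h f) = f h := by
  rw [rightArrow_eq_sum f h (Repr.arbitrary k h),
    ← WDual.counit_sum_right f h (Repr.arbitrary k h)]
  simp

variable [FiniteDimensional k H] {ℓ : H} {lam : WDual k H}

namespace IsDualPair

/-- The element `y ∈ H_s` with `ℓh = ℓy` is `1₁ α(h S(1₂))`, where `α = λ ↼ ℓ`. -/
theorem mul_eq_mul_sum (hd : IsDualPair ℓ lam)
    (ht : ∀ z ∈ targetBase k H, antipode k (antipode k z) = z)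
    (hs : ∀ y ∈ sourceBase k H, antipode k (antipode k y) = y) (h : H) :
    ℓ * h = ℓ * ∑ j ∈ (baseRepr k H).index,
      lam (ℓ * (h * antipode k ((baseRepr k H).right j))) • (baseRepr k H).left j := by
  obtain ⟨y, hy, hyh⟩ := hd.exists_modularMap_eq (hd.modularMap_mem h)
  have h1 : ℓ * h = ℓ * y := by rw [← hd.mul_modularMap h, ← hyh, hd.mul_modularMap]
  rw [h1]
  congr 1
  conv_lhs => rw [← counitalSource_of_mem hy, counitalSource_apply y (baseRepr k H)]
  refine Finset.sum_congr rfl fun j _ => ?_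
  have hm := antipode_target_mem (baseRepr_right_mem (k := k) (H := H) j)
  rw [← mul_assoc, h1, mul_assoc, ← counit_modularMap,
    hd.counit_modularMap_source ht hs (mul_mem_sourceBase hy hm), ← counit_mul_counitalTarget y
    (antipode k _), ← antipode_source hm, ht _ (baseRepr_right_mem j)]

/-- `ℓ₁ x ⊗ ℓ₂ = ℓ₁ ⊗ ℓ₂ S(x ↼ α)`, where `α = λ ↼ ℓ`. -/
theorem comul_mul_tmul_one (hd : IsDualPair ℓ lam)
    (ht : ∀ z ∈ targetBase k H, antipode k (antipode k z) = z)
    (hs : ∀ y ∈ sourceBase k H, antipode k (antipode k y) = y) (x : H) :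
    comul (R := k) ℓ * (x ⊗ₜ[k] (1 : H)) = comul ℓ * ((1 : H) ⊗ₜ[k] antipode k
      (rightArrow x (WDual.toDual (rightArrow lam (WDual.evalAt (k := k) ℓ))))) := by
  set α : WDual k H := rightArrow lam (WDual.evalAt (k := k) ℓ) with hα
  have hαe (h : H) : α h = lam (ℓ * h) := rightArrow_evalAt _ _ _
  let r := Repr.arbitrary k x
  let B := baseRepr k H
  have h1 (j) : ∑ i ∈ r.index,
      α (r.left i * antipode k (B.right j)) • antipode k (r.right i) =
      ∑ i ∈ r.index, α (r.left i) • antipode k (r.right i * B.right j) := by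
    have := congrArg ((TensorProduct.lid k H).toLinearMap ∘ₗ
      TensorProduct.map (WDual.toDual α) (antipode k))
      (comul_mul_antipode_target ht (baseRepr_right_mem (k := k) (H := H) j) x)
    rw [← r.eq] at this
    simpa [Finset.sum_mul] using this
  calc comul (R := k) ℓ * (x ⊗ₜ[k] (1 : H))
      = comul ℓ * (comul (1 : H) * (x ⊗ₜ[k] (1 : H))) := by rw [← mul_assoc, comul_mul_one]
    _ = ∑ i ∈ r.index,
          comul (ℓ * r.left i) * ((1 : H) ⊗ₜ[k] antipode k (r.right i)) := by
        rw [← lTensor_counitalTarget_comul, ← sum_comul_mul_antipode x r, Finset.mul_sum]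
        simp only [comul_mul, mul_assoc]
    _ = ∑ i ∈ r.index, comul ℓ * ((1 : H) ⊗ₜ[k] ((∑ j ∈ B.index,
          α (r.left i * antipode k (B.right j)) • B.left j) * antipode k (r.right i))) := by
        refine Finset.sum_congr rfl fun i _ => ?_
        rw [hd.mul_eq_mul_sum ht hs, comul_mul_source (Submodule.sum_mem _ fun j _ =>
          Submodule.smul_mem _ _ (baseRepr_left_mem j)), mul_assoc,
          Algebra.TensorProduct.tmul_mul_tmul, one_mul]
        simp only [hαe]
        rfl
    _ = comul ℓ * ((1 : H) ⊗ₜ[k] ∑ j ∈ B.index, B.left j *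
          ∑ i ∈ r.index, α (r.left i * antipode k (B.right j)) • antipode k (r.right i)) := by
        rw [← Finset.mul_sum, ← tmul_sum]
        simp only [Finset.sum_mul, Finset.mul_sum, smul_mul_assoc, mul_smul_comm]
        rw [Finset.sum_comm]
    _ = comul ℓ * ((1 : H) ⊗ₜ[k] ((∑ j ∈ B.index, B.left j * antipode k (B.right j)) *
          ∑ i ∈ r.index, α (r.left i) • antipode k (r.right i))) := by
        simp only [h1, antipode_mul_rev, Finset.sum_mul, Finset.mul_sum, mul_smul_comm, mul_assoc]
        rw [Finset.sum_comm]
        simp only [Finset.smul_sum]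
    _ = _ := by
        rw [sum_base_mul_antipode, one_mul, rightArrow_eq_sum _ x r]
        simp

/-- The Nakayama automorphism of `λ`: `λ(nu) = λ(u N(n))` with `N(n) = S(S(n) ↼ α)`. -/
theorem apply_mul_comm (hd : IsDualPair ℓ lam)
    (ht : ∀ z ∈ targetBase k H, antipode k (antipode k z) = z)
    (hs : ∀ y ∈ sourceBase k H, antipode k (antipode k y) = y) (n u : H) :
    lam (n * u) = lam (u * antipode k (rightArrow (antipode k n)
      (WDual.toDual (rightArrow lam (WDual.evalAt (k := k) ℓ))))) := by
  set w := antipode k (rightArrow (antipode k n)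
      (WDual.toDual (rightArrow lam (WDual.evalAt (k := k) ℓ)))) with hw
  let r := Repr.arbitrary k ℓ
  have h1 := congrArg ((TensorProduct.rid k H).toLinearMap ∘ₗ (WDual.toDual lam).lTensor H)
    (hd.comul_mul_tmul_one ht hs (antipode k n))
  rw [← hw, ← r.eq] at h1
  simp only [Finset.sum_mul, Algebra.TensorProduct.tmul_mul_tmul, mul_one, LinearMap.comp_apply,
    map_sum, LinearMap.lTensor_tmul, LinearEquiv.coe_coe, TensorProduct.rid_tmul,
    ← smul_mul_assoc] at h1
  rw [← Finset.sum_mul, ← leftArrow_eq_sum _ ℓ r, hd.2.2, one_mul, ← hd.leftArrow_mulLeft n,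
    leftArrow_eq_sum _ ℓ r] at h1
  have h2 : WDual.toDual.symm (WDual.toDual lam ∘ₗ LinearMap.mulLeft k n -
      WDual.toDual lam ∘ₗ LinearMap.mulRight k w) = (0 : WDual k H) := by
    refine hd.nondegenerate_integral.2.2 _ fun φ => ?_
    have h3 := congrArg (WDual.toDual φ) h1
    rw [WDual.evalAt_apply, WDual.mul_eval _ _ ℓ r]
    simp only [LinearEquiv.apply_symm_apply, LinearMap.sub_apply, mul_sub,
      Finset.sum_sub_distrib, sub_eq_zero]
    simpa [mul_comm] using h3
  have h4 := congrArg (fun χ : WDual k H => χ u) h2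
  exact sub_eq_zero.1 h4

/-- The functional `α` of the dual pair `λ`, `ℓ` for `H*` is `a = ℓ ↼ λ`, viewed in `H**`. -/
theorem dual_rightArrow :
    (rightArrow (biDual (k := k) ℓ) (WDual.evalAt (k := k) lam) : WDual k (WDual k H)) =
      biDual (rightArrow ℓ (WDual.toDual lam)) := by
  ext φ
  rw [rightArrow_evalAt, biDual_apply, biDual_apply, WDual.mul_eval _ _ ℓ (Repr.arbitrary k ℓ),
    rightArrow_eq_sum _ ℓ (Repr.arbitrary k ℓ)]
  simp

/-- `λ(h₁ g) h₂ = λ(h g₁) a S(g₂)`, where `a = ℓ ↼ λ`. This is `comul_mul_tmul_one` for the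
dual pair `λ`, `ℓ` of `H*`. -/
theorem sum_apply_mul_smul (hd : IsDualPair ℓ lam)
    (ht : ∀ z ∈ targetBase k H, antipode k (antipode k z) = z)
    (hs : ∀ y ∈ sourceBase k H, antipode k (antipode k y) = y) (h g : H) {ι κ : Type*}
    (r : Repr k h ι) (s : Repr k g κ) :
    ∑ i ∈ r.index, lam (r.left i * g) • r.right i =
      ∑ j ∈ s.index, lam (h * s.left j) •
        (rightArrow ℓ (WDual.toDual lam) * antipode k (s.right j)) := by
  set a := rightArrow ℓ (WDual.toDual lam) with ha
  refine eq_of_forall_dual (k := k) fun φ => ?_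
  let φ' : WDual k H := WDual.toDual.symm φ
  have h1 := congrArg (WDual.ev₂ h g) (hd.dual.comul_mul_tmul_one
    (antipode_antipode_target_dual hs) (antipode_antipode_source_dual ht) φ')
  rw [dual_rightArrow, WDual.ev₂_mul h g _ _ r s, WDual.ev₂_mul h g _ _ r s] at h1
  have h2 : (antipode k (rightArrow φ' (WDual.toDual (biDual (k := k) a))) : WDual k H) =
      WDual.toDual.symm (φ ∘ₗ LinearMap.mulLeft k a ∘ₗ antipode k) := by
    ext x
    exact rightArrow_evalAt φ' a (antipode k x)
  rw [h2] at h1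
  simp only [WDual.ev₂_comul, WDual.ev₂_tmul, WDual.one_eval] at h1
  simp only [map_sum, map_smul, smul_eq_mul]
  refine Eq.trans ?_ (h1.trans ?_)
  · refine Finset.sum_congr rfl fun i _ => ?_
    have h3 := WDual.counit_sum_right (WDual.toDual lam ∘ₗ LinearMap.mulLeft k (r.left i)) g s
    simp only [LinearMap.comp_apply, LinearMap.mulLeft_apply] at h3
    rw [← h3, Finset.sum_mul]
    refine Finset.sum_congr rfl fun j _ => ?_
    simp only [φ', LinearEquiv.apply_symm_apply]
    ring
  · rw [Finset.sum_comm]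
    refine Finset.sum_congr rfl fun j _ => ?_
    have h3 := WDual.counit_sum_right (WDual.toDual lam ∘ₗ LinearMap.mulRight k (s.left j)) h r
    simp only [LinearMap.comp_apply, LinearMap.mulRight_apply] at h3
    rw [← h3, Finset.sum_mul]
    refine Finset.sum_congr rfl fun i _ => ?_
    simp only [LinearMap.comp_apply, LinearMap.mulLeft_apply, LinearEquiv.apply_symm_apply]
    ring

end IsDualPair

/-- `S(h) ↼ φ = S(S(φ) ⇀ h)`. -/
theorem rightArrow_antipode (φ : WDual k H) (h : H) :
    rightArrow (antipode k h) (WDual.toDual φ) =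
      antipode k (leftArrow (WDual.toDual (antipode k φ)) h) := by
  rw [rightArrow, comul_antipode, leftArrow_eq_sum _ h (Repr.arbitrary k h),
    ← (Repr.arbitrary k h).eq]
  simp only [map_sum, TensorProduct.map_tmul, TensorProduct.comm_tmul, LinearMap.rTensor_tmul,
    TensorProduct.lid_tmul, map_smul]
  rfl

/-- The two descriptions of the Nakayama automorphism `N` of `λ`, by `α` and by `a`: with
`N(h) = S²(α⁻¹ ⇀ h)`, also `h ↼ α⁻¹ = a S²(N(h)) a⁻¹`. Here `S(α)` and `S(a)` stand for the inverses
of `α` and `a`. -/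
theorem IsDualPair.rightArrow_antipode_eq (hd : IsDualPair ℓ lam)
    (ht : ∀ z ∈ targetBase k H, antipode k (antipode k z) = z)
    (hs : ∀ y ∈ sourceBase k H, antipode k (antipode k y) = y) (h : H) :
    rightArrow h (WDual.toDual (antipode k (rightArrow lam (WDual.evalAt (k := k) ℓ)))) =
      rightArrow ℓ (WDual.toDual lam) *
        antipode k (antipode k (antipode k (antipode k (leftArrow (WDual.toDual
          (antipode k (rightArrow lam (WDual.evalAt (k := k) ℓ)))) h)))) *
        antipode k (rightArrow ℓ (WDual.toDual lam)) := by
  set a := rightArrow ℓ (WDual.toDual lam) with ha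
  set α : WDual k H := rightArrow lam (WDual.evalAt (k := k) ℓ) with hα
  let N : H → H := fun n => antipode k (rightArrow (antipode k n) (WDual.toDual α))
  have hN (n u : H) : lam (n * u) = lam (u * N n) := hd.apply_mul_comm ht hs n u
  have hN2 : N h = antipode k (antipode k (leftArrow (WDual.toDual (antipode k α)) h)) := by
    simp only [N, rightArrow_antipode]
  have hεN (n : H) : counit (R := k) (N n) = (antipode k α) n := by
    simp only [N, counit_antipode, counit_rightArrow]
    rfl
  -- the counit is `λ(g ·)` for some `g`
  obtain ⟨g, hg⟩ := exists_eq_mul_left_of_nondegenerate hd.nondegenerate_functional.1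
    (counit (R := k) (A := H))
  let r := Repr.arbitrary k h
  let s := Repr.arbitrary k g
  let t := Repr.arbitrary k (N h)
  rw [← hN2]
  calc rightArrow h (WDual.toDual (antipode k α))
      = ∑ i ∈ r.index, lam (r.left i * g) • r.right i := by
        rw [rightArrow_eq_sum _ h r]
        refine Finset.sum_congr rfl fun i _ => ?_
        rw [hN, ← hg, hεN]
    _ = a * antipode k (∑ j ∈ s.index, lam (s.left j * N h) • s.right j) := by
        rw [hd.sum_apply_mul_smul ht hs h g r s]
        simp only [hN h, map_sum, map_smul, Finset.mul_sum, mul_smul_comm, ← ha]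
    _ = a * antipode k (a * antipode k (∑ m ∈ t.index, lam (g * t.left m) • t.right m)) := by
        rw [hd.sum_apply_mul_smul ht hs g (N h) s t]
        simp only [map_sum, map_smul, Finset.mul_sum, mul_smul_comm, ← ha]
    _ = a * antipode k (antipode k (N h)) * antipode k a := by
        simp only [← hg]
        rw [Coalgebra.sum_counit_smul, antipode_mul_rev, mul_assoc]

end Radford

/-! ### Radford's formula -/

section Main

variable {k H : Type*} [Field k] [Ring H] [WeakHopfAlgebra k H]

theorem antipode_antipode_of_mem_targetBase
    (hmin : ∀ x ∈ minimalSubalgebra k H, antipode k (antipode k x) = x) :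
    ∀ z ∈ targetBase k H, antipode k (antipode k z) = z := fun z hz => by
  have h1 := Submodule.mul_mem_mul hz (one_mem_sourceBase (k := k) (H := H))
  rw [mul_one] at h1
  exact hmin z h1

theorem antipode_antipode_of_mem_sourceBase
    (hmin : ∀ x ∈ minimalSubalgebra k H, antipode k (antipode k x) = x) :
    ∀ y ∈ sourceBase k H, antipode k (antipode k y) = y := fun y hy => by
  have h1 := Submodule.mul_mem_mul (one_mem_targetBase (k := k) (H := H)) hy
  rw [one_mul] at h1
  exact hmin y h1

variable [FiniteDimensional k H] {ℓ : H} {lam : WDual k H}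

/-- The element `a = ℓ ↼ λ` has the inverse `S(a)` and is distinguished, by the corresponding facts
for the dual pair `λ`, `ℓ` of `H*`. -/
theorem IsDualPair.isDistinguishedElement_rightArrow (hd : IsDualPair ℓ lam)
    (ht : ∀ z ∈ targetBase k H, antipode k (antipode k z) = z)
    (hs : ∀ y ∈ sourceBase k H, antipode k (antipode k y) = y) :
    rightArrow ℓ (WDual.toDual lam) * antipode k (rightArrow ℓ (WDual.toDual lam)) = 1 ∧
      antipode k (rightArrow ℓ (WDual.toDual lam)) * rightArrow ℓ (WDual.toDual lam) = 1 ∧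
      IsDistinguishedElement k (rightArrow ℓ (WDual.toDual lam)) := by
  have ht' := antipode_antipode_target_dual hs
  have hs' := antipode_antipode_source_dual ht
  have ha1 := hd.dual.rightArrow_mul_antipode ht' hs'
  have ha2 := hd.dual.antipode_mul_rightArrow ht' hs'
  have hac := hd.dual.comul_rightArrow ht' hs'
  have had := hd.dual.isDistinguished_rightArrow ht' hs'
  rw [IsDualPair.dual_rightArrow] at ha1 ha2 hac had
  rw [antipode_biDual, ← biDual_mul, ← biDual_one] at ha1 ha2
  replace ha1 := biDual_injective ha1
  replace ha2 := biDual_injective ha2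
  exact ⟨ha1, ha2, isGroupLike_of_comul_eq (comul_eq_of_biDual hac) ha1 ha2, had⟩

/-- The relation `h ↼ α⁻¹ = a S⁴(α⁻¹ ⇀ h) a⁻¹`, with `α ⇀ h` in place of `h`. -/
theorem IsDualPair.antipode_iterate_four (hd : IsDualPair ℓ lam)
    (ht : ∀ z ∈ targetBase k H, antipode k (antipode k z) = z)
    (hs : ∀ y ∈ sourceBase k H, antipode k (antipode k y) = y) (h : H) :
    (⇑(antipode k (H := H)))^[4] h = antipode k (rightArrow ℓ (WDual.toDual lam)) *
      rightArrow (leftArrow (WDual.toDual (rightArrow lam (WDual.evalAt (k := k) ℓ))) h)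
        (WDual.toDual (antipode k (rightArrow lam (WDual.evalAt (k := k) ℓ)))) *
      rightArrow ℓ (WDual.toDual lam) := by
  have ha := (hd.isDistinguishedElement_rightArrow ht hs).2.1
  have h1 := hd.rightArrow_antipode_eq ht hs
    (leftArrow (WDual.toDual (rightArrow lam (WDual.evalAt (k := k) ℓ))) h)
  rw [leftArrow_leftArrow, hd.antipode_mul_rightArrow ht hs, leftArrow_one] at h1
  rw [h1, ← mul_assoc, ← mul_assoc, ha, one_mul, mul_assoc, ha, mul_one]
  rfl

end Main

end WeakHopfAlgebra

theorem mainTheorem1 {k H : Type*} [Field k] [Ring H] [WeakHopfAlgebra k H]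
    [FiniteDimensional k H]
    (hFrobenius : IsFrobeniusAlgebra k H)
    (hmin : ∀ x ∈ WeakHopfAlgebra.minimalSubalgebra k H,
      WeakHopfAlgebra.antipode k (WeakHopfAlgebra.antipode k x) = x)
    (ℓ : H) (lam : WDual k H) (hdual : WeakHopfAlgebra.IsDualPair ℓ lam) :
    ∃ (a : Hˣ) (α : (WDual k H)ˣ),
      (a : H) = WeakHopfAlgebra.rightArrow ℓ (WDual.toDual lam) ∧
      (α : WDual k H) = WeakHopfAlgebra.rightArrow lam (WDual.evalAt ℓ) ∧
      WeakHopfAlgebra.IsDistinguishedElement k (a : H) ∧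
      WeakHopfAlgebra.IsDistinguished (α : WDual k H) ∧
      ∀ h : H, (⇑(WeakHopfAlgebra.antipode k (H := H)))^[4] h =
        (↑a⁻¹ : H) * WeakHopfAlgebra.rightArrow
          (WeakHopfAlgebra.leftArrow (WDual.toDual (α : WDual k H)) h)
          (WDual.toDual (↑α⁻¹ : WDual k H)) * (a : H) := by
  have ht := WeakHopfAlgebra.antipode_antipode_of_mem_targetBase hmin
  have hs := WeakHopfAlgebra.antipode_antipode_of_mem_sourceBase hmin
  obtain ⟨ha1, ha2, ha⟩ := hdual.isDistinguishedElement_rightArrow ht hs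
  exact ⟨⟨_, _, ha1, ha2⟩,
    ⟨_, _, hdual.rightArrow_mul_antipode ht hs, hdual.antipode_mul_rightArrow ht hs⟩, rfl, rfl, ha,
    hdual.isDistinguished_rightArrow ht hs, hdual.antipode_iterate_four ht hs⟩
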